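/- Model. Fix an integer $K\ge 2$ and constants $A,B,\tau>0$ with $KA\le B<1$ and $\tau\le (1-B)/K$. Let $(\mathcal A,Q)$ be a probability space and, for each $u\in\mathcal A$, let $S_1(u),\dots,S_K(u)$ be similarities of $[0,1]$ into itself with scaling ratios $a(i,u)$, measurable in $u$, such that $A\le a(i,u)$, $\sum_{i=1}^K a(i,u)\le B$, and $\mathrm{dist}(S_i(u)[0,1],S_j(u)[0,1])\ge\tau$ for $i\ne j$. Let $\mathcal W=\{p\in\mathbb R^K: p_i\ge 0,\ \sum_i p_i=1\}$. An admissible choice of random probability weights is a probability measure $\mathbb P$ on $\Lambda=\mathcal A\times\mathcal W$ with marginal $Q$ on $\mathcal A$ such that, writing $\lambda=(u,p)$ and $p(i,\lambda)=p_i$, there is $t>0$ with $\mathbb E_{\mathbb P}\big(p(i,\lambda)^{-t}\big)<\infty$ for every $i$ (the weights may depend on $u$). For $\boldsymbol\lambda=(\lambda_n)_{n\ge1}=((u_n,p_n))_{n\ge 1}\in\Lambda^{\mathbb N}$, let $I_{i_1\dots i_n}(\boldsymbol\lambda)=S_{i_1}(u_1)\circ\cdots\circ S_{i_n}(u_n)[0,1]$,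 let $F_{\boldsymbol\lambda}=\bigcap_n\bigcup_{i_1,\dots,i_n}I_{i_1\dots i_n}(\boldsymbol\lambda)$, and let $\mu_{\boldsymbol\lambda}$ be the Borel probability measure on $[0,1]$ with $\mu_{\boldsymbol\lambda}(I_{i_1\dots i_n}(\boldsymbol\lambda))=p(i_1,\lambda_1)\cdots p(i_n,\lambda_n)$ for all words. The set $F_{\boldsymbol\lambda}$ depends only on $(u_n)$. Dimensions. A dimension function is a map $\Phi:(0,1)\to[0,\infty)$ such that $t^{1+\Phi(t)}$ decreases to $0$ as $t$ decreases to $0$, and such that for some $T,C>0$, $(2t)^{1+\Phi(2t)}\le C\,t^{1+\Phi(t)}$ for all $0<t<T$. It is large if $\Phi(t)=H(t)\,\frac{\log|\log t|}{|\log t|}$ for all small $t$, with $H(t)\to\infty$ as $t\to0^+$. Let $B(x,R)$ be the open ball in $[0,1]$ with centre $x$ and radius $R$. The lower $\Phi$-dimension $\underline{\dim}_\Phi\mu$ is the supremum of the $d\in\mathbb R$ for which there are $C_1,C_2>0$ such that $\mu(B(x,R))/\mu(B(x,r))\ge C_2(R/r)^d$ for all $x\in\operatorname{supp}\mu$ and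 all $0<r<R^{1+\Phi(R)}\le R\le C_1$. A measure $\mu$ is doubling if there is $C$ with $\mu(B(x,2R))\le C\mu(B(x,R))$ for all $x\in\operatorname{supp}\mu$ and $R>0$. Theorem. There is a number $D>0$ with $\dim_H F_{\boldsymbol\lambda}=D$ almost surely; $D$ is the unique solution $x\ge0$ of $\mathbb E_Q\big(\log\sum_{i=1}^K a(i,u)^x\big)=0$. For every $d\in(0,D]$ there is an admissible choice $\mathbb P$ of random probability weights such that, for $\mathbb P^{\mathbb N}$-almost every $\boldsymbol\lambda$, the measure $\mu_{\boldsymbol\lambda}$ is doubling and $\underline{\dim}_\Phi\mu_{\boldsymbol\lambda}=d$ for every large dimension function $\Phi$. -/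

import Mathlib

open MeasureTheory Filter Set
open scoped ENNReal Topology

namespace RandomMoran

noncomputable section

/-! ### Dimension functions and lower dimensions of measures -/

/-- A dimension function: only the values of `Φ` on `(0,1)` matter. -/
structure IsDimensionFunction (Φ : ℝ → ℝ) : Prop where
  nonneg : ∀ t ∈ Ioo (0 : ℝ) 1, 0 ≤ Φ t
  mono : MonotoneOn (fun t : ℝ => t ^ (1 + Φ t)) (Ioo 0 1)
  tendsto_zero : Tendsto (fun t : ℝ => t ^ (1 + Φ t)) (𝓝[>] 0) (𝓝 0)
  doubling : ∃ T > 0, ∃ C > 0, ∀ t : ℝ, 0 < t → t < T →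
    (2 * t) ^ (1 + Φ (2 * t)) ≤ C * t ^ (1 + Φ t)

/-- A large dimension function: `Φ t = H t * log |log t| / |log t|` near `0`, with `H t → ∞`
as `t → 0+`. -/
structure IsLargeDimensionFunction (Φ : ℝ → ℝ) : Prop extends IsDimensionFunction Φ where
  large : ∃ H : ℝ → ℝ, Tendsto H (𝓝[>] 0) atTop ∧
    ∀ᶠ t in 𝓝[>] (0 : ℝ), Φ t = H t * (Real.log |Real.log t| / |Real.log t|)

variable {X : Type*} [MetricSpace X] [MeasurableSpace X]

/-- The exponents admitted in the definition of the lower `Φ`-dimension of a measure. -/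
def lowerExponents (Φ : ℝ → ℝ) (μ : Measure X) : Set ℝ :=
  {d | ∃ C₁ > 0, ∃ C₂ > 0, ∀ r R : ℝ, 0 < r → r < R ^ (1 + Φ R) → R ^ (1 + Φ R) ≤ R → 0 < R →
    R ≤ C₁ → ∀ x ∈ μ.support,
      C₂ * (R / r) ^ d ≤ μ.real (Metric.ball x R) / μ.real (Metric.ball x r)}

/-- The lower `Φ`-dimension of a measure, the supremum (in the extended reals) of the admitted
exponents. -/
def lowerPhiDim (Φ : ℝ → ℝ) (μ : Measure X) : EReal :=
  ⨆ d ∈ lowerExponents Φ μ, (d : EReal)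

/-- A measure is doubling if `μ(B(x,2R)) ≤ C μ(B(x,R))` for all `x` in its support. -/
def IsDoubling (μ : Measure X) : Prop :=
  ∃ C : ℝ, ∀ x ∈ μ.support, ∀ R : ℝ, 0 < R →
    μ.real (Metric.ball x (2 * R)) ≤ C * μ.real (Metric.ball x R)

/-! ### The random model -/

/-- A family, indexed by `u : 𝒜`, of iterated function systems of `K ≥ 2` similarities
`map u 0, …, map u (K - 1)` of `[0,1]` into itself with scaling ratios `ratio u i`, uniformly
bounded and uniformly strongly separated. -/
structure IFSFamily (𝒜 : Type*) [MeasurableSpace 𝒜] (K : ℕ) where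
  map : 𝒜 → Fin K → unitInterval → unitInterval
  ratio : 𝒜 → Fin K → ℝ
  A : ℝ
  B : ℝ
  τ : ℝ
  two_le : 2 ≤ K
  A_pos : 0 < A
  KA_le : K * A ≤ B
  B_lt_one : B < 1
  τ_pos : 0 < τ
  τ_le : τ ≤ (1 - B) / K
  measurable_ratio : ∀ i, Measurable fun u => ratio u i
  dist_map : ∀ u i x y, dist (map u i x) (map u i y) = ratio u i * dist x y
  le_ratio : ∀ u i, A ≤ ratio u i
  sum_ratio_le : ∀ u, ∑ i, ratio u i ≤ B
  separated : ∀ u i j, i ≠ j → ∀ x y, τ ≤ dist (map u i x) (map u j y)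

/-- The space of all probability weight vectors. -/
abbrev Weights (K : ℕ) : Type := stdSimplex ℝ (Fin K)

/-- The probability measure on `{0, …, K - 1}` with weight vector `p`. -/
def weightMeasure {K : ℕ} (p : Weights K) : Measure (Fin K) :=
  ∑ i, ENNReal.ofReal (p.1 i) • Measure.dirac i

theorem weightMeasure_singleton {K : ℕ} (p : Weights K) (i : Fin K) :
    weightMeasure p {i} = ENNReal.ofReal (p.1 i) := by
  simp [weightMeasure, Set.indicator_apply]

instance {K : ℕ} (p : Weights K) : IsProbabilityMeasure (weightMeasure p) := by
  constructor
  simp only [weightMeasure, Measure.coe_finsetSum, Finset.sum_apply, Measure.smul_apply,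
    measure_univ, smul_eq_mul, mul_one]
  rw [← ENNReal.ofReal_sum_of_nonneg (fun i _ => p.2.1 i), p.2.2, ENNReal.ofReal_one]

variable {𝒜 : Type*} [MeasurableSpace 𝒜] {K : ℕ}

namespace IFSFamily

variable (𝓘 : IFSFamily 𝒜 K)

/-- The composition `S_{i 0}(u 0) ∘ ⋯ ∘ S_{i (n-1)}(u (n-1))`. -/
def comp (u : ℕ → 𝒜) (i : ℕ → Fin K) : ℕ → unitInterval → unitInterval
  | 0 => id
  | n + 1 => comp u i n ∘ 𝓘.map (u n) (i n)

/-- The step `n` Moran interval of the word `i 0, …, i (n-1)`. (It depends only on the first `n`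
terms of the sequence `i`.) -/
def moranInterval (u : ℕ → 𝒜) (i : ℕ → Fin K) (n : ℕ) : Set unitInterval :=
  range (𝓘.comp u i n)

/-- The Moran set: the intersection over `n` of the union of the step `n` Moran intervals. -/
def moranSet (u : ℕ → 𝒜) : Set unitInterval :=
  ⋂ n : ℕ, ⋃ i : ℕ → Fin K, 𝓘.moranInterval u i n

/-- The coding map: the common point of the nested Moran intervals along the sequence `i`. -/
def code (u : ℕ → 𝒜) (i : ℕ → Fin K) : unitInterval :=
  limUnder atTop fun n => 𝓘.comp u i n 0

/-- The Moran measure with systems `(ω n).1` and weights `(ω n).2` at step `n`: the image under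
the coding map of the product of the weight measures. It is the probability measure that gives
the Moran interval of a word the product of the weights along the word; see
`moranMeasure_moranInterval`. -/
def moranMeasure (ω : ℕ → 𝒜 × Weights K) : Measure unitInterval :=
  (Measure.infinitePi fun n => weightMeasure (ω n).2).map (𝓘.code fun n => (ω n).1)

theorem ratio_nonneg (u : 𝒜) (i : Fin K) : 0 ≤ 𝓘.ratio u i :=
  𝓘.A_pos.le.trans (𝓘.le_ratio u i)

theorem ratio_le (u : 𝒜) (i : Fin K) : 𝓘.ratio u i ≤ 𝓘.B :=
  (Finset.single_le_sum (fun j _ => 𝓘.ratio_nonneg u j) (Finset.mem_univ i)).trans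
    (𝓘.sum_ratio_le u)

theorem dist_comp (u : ℕ → 𝒜) (i : ℕ → Fin K) (n : ℕ) (x y : unitInterval) :
    dist (𝓘.comp u i n x) (𝓘.comp u i n y)
      = (∏ m ∈ Finset.range n, 𝓘.ratio (u m) (i m)) * dist x y := by
  induction n generalizing x y with
  | zero => simp [comp]
  | succ n ih => simp only [comp, Function.comp, ih, 𝓘.dist_map, Finset.prod_range_succ]; ring

theorem prod_ratio_le (u : ℕ → 𝒜) (i : ℕ → Fin K) (n : ℕ) :
    ∏ m ∈ Finset.range n, 𝓘.ratio (u m) (i m) ≤ 𝓘.B ^ n := by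
  calc ∏ m ∈ Finset.range n, 𝓘.ratio (u m) (i m)
      ≤ ∏ _m ∈ Finset.range n, 𝓘.B :=
        Finset.prod_le_prod (fun m _ => 𝓘.ratio_nonneg _ _) (fun m _ => 𝓘.ratio_le _ _)
    _ = 𝓘.B ^ n := by simp

theorem prod_ratio_pos (u : ℕ → 𝒜) (i : ℕ → Fin K) (n : ℕ) :
    0 < ∏ m ∈ Finset.range n, 𝓘.ratio (u m) (i m) :=
  Finset.prod_pos fun _ _ => 𝓘.A_pos.trans_le (𝓘.le_ratio _ _)

theorem B_pos : 0 < 𝓘.B := by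
  have h : (0 : ℝ) < K := by exact_mod_cast (by have := 𝓘.two_le; omega : 0 < K)
  exact (mul_pos h 𝓘.A_pos).trans_le 𝓘.KA_le

theorem dist_le_of_mem (u : ℕ → 𝒜) (i : ℕ → Fin K) (n : ℕ) {x y : unitInterval}
    (hx : x ∈ 𝓘.moranInterval u i n) (hy : y ∈ 𝓘.moranInterval u i n) :
    dist x y ≤ 𝓘.B ^ n := by
  obtain ⟨a, rfl⟩ := hx
  obtain ⟨b, rfl⟩ := hy
  rw [dist_comp]
  have h1 : dist a b ≤ 1 := by
    rw [Subtype.dist_eq, Real.dist_eq, abs_le]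
    constructor <;> linarith [a.2.1, a.2.2, b.2.1, b.2.2]
  calc _ ≤ 𝓘.B ^ n * 1 := mul_le_mul (𝓘.prod_ratio_le u i n) h1 dist_nonneg
        (pow_nonneg 𝓘.B_pos.le n)
    _ = _ := mul_one _

theorem moranInterval_anti (u : ℕ → 𝒜) (i : ℕ → Fin K) : Antitone (𝓘.moranInterval u i) := by
  refine antitone_nat_of_succ_le fun n => ?_
  rintro _ ⟨x, rfl⟩
  exact ⟨𝓘.map (u n) (i n) x, rfl⟩

theorem comp_congr (u : ℕ → 𝒜) {i j : ℕ → Fin K} {n : ℕ} (h : ∀ m < n, i m = j m) :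
    𝓘.comp u i n = 𝓘.comp u j n := by
  induction n with
  | zero => rfl
  | succ n ih =>
    simp only [comp, ih fun m hm => h m (hm.trans n.lt_succ_self), h n n.lt_succ_self]

theorem continuous_comp (u : ℕ → 𝒜) (i : ℕ → Fin K) (n : ℕ) : Continuous (𝓘.comp u i n) := by
  refine (LipschitzWith.of_dist_le_mul (K := 1) fun x y => ?_).continuous
  rw [dist_comp, NNReal.coe_one]
  exact mul_le_mul_of_nonneg_right ((𝓘.prod_ratio_le u i n).trans
    (pow_le_one₀ 𝓘.B_pos.le 𝓘.B_lt_one.le)) dist_nonneg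

theorem isCompact_moranInterval (u : ℕ → 𝒜) (i : ℕ → Fin K) (n : ℕ) :
    IsCompact (𝓘.moranInterval u i n) :=
  isCompact_range (𝓘.continuous_comp u i n)

theorem tendsto_code (u : ℕ → 𝒜) (i : ℕ → Fin K) :
    Tendsto (fun n => 𝓘.comp u i n 0) atTop (𝓝 (𝓘.code u i)) := by
  have : CauchySeq fun n => 𝓘.comp u i n 0 := by
    refine cauchySeq_of_le_geometric 𝓘.B 1 𝓘.B_lt_one fun n => ?_
    rw [one_mul]
    exact 𝓘.dist_le_of_mem u i n ⟨0, rfl⟩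
      (𝓘.moranInterval_anti u i n.le_succ ⟨0, rfl⟩)
  exact this.tendsto_limUnder

theorem code_mem (u : ℕ → 𝒜) (i : ℕ → Fin K) (n : ℕ) :
    𝓘.code u i ∈ 𝓘.moranInterval u i n :=
  (𝓘.isCompact_moranInterval u i n).isClosed.mem_of_tendsto (𝓘.tendsto_code u i)
    ((eventually_ge_atTop n).mono fun _ hm => 𝓘.moranInterval_anti u i hm ⟨0, rfl⟩)

/-- Distinct words of the same length have disjoint Moran intervals. -/
theorem eq_of_mem (u : ℕ → 𝒜) {i j : ℕ → Fin K} {n : ℕ} {x : unitInterval}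
    (hi : x ∈ 𝓘.moranInterval u i n) (hj : x ∈ 𝓘.moranInterval u j n) :
    ∀ m < n, i m = j m := by
  induction n with
  | zero => intro m hm; omega
  | succ n ih =>
    have h := ih (𝓘.moranInterval_anti u i n.le_succ hi) (𝓘.moranInterval_anti u j n.le_succ hj)
    intro m hm
    rcases Nat.lt_succ_iff_lt_or_eq.mp hm with hm | rfl
    · exact h m hm
    · obtain ⟨y, hy⟩ := hi
      obtain ⟨z, hz⟩ := hj
      by_contra hne
      simp only [comp, Function.comp, 𝓘.comp_congr u h] at hy hz
      have h0 := 𝓘.dist_comp u j m (𝓘.map (u m) (i m) y) (𝓘.map (u m) (j m) z)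
      rw [hy, hz, dist_self] at h0
      have := mul_pos (𝓘.prod_ratio_pos u j m)
        (𝓘.τ_pos.trans_le (𝓘.separated (u m) _ _ hne y z))
      linarith

theorem code_preimage (u : ℕ → 𝒜) (i : ℕ → Fin K) (n : ℕ) :
    𝓘.code u ⁻¹' 𝓘.moranInterval u i n = {j | ∀ m < n, j m = i m} := by
  ext j
  refine ⟨fun h => 𝓘.eq_of_mem u (𝓘.code_mem u j n) h, fun h => ?_⟩
  have := 𝓘.code_mem u j n
  rwa [moranInterval, 𝓘.comp_congr u h] at this

theorem continuous_code (u : ℕ → 𝒜) : Continuous (𝓘.code u) := by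
  rw [continuous_iff_continuousAt]
  intro i
  rw [ContinuousAt, Metric.tendsto_nhds]
  intro ε hε
  obtain ⟨n, hn⟩ := exists_pow_lt_of_lt_one hε 𝓘.B_lt_one
  have : ∀ᶠ j in 𝓝 i, ∀ m ∈ Finset.range n, j m = i m := by
    rw [Filter.eventually_all_finset]
    intro m _
    exact (continuous_apply m).continuousAt.eventually
      ((isOpen_discrete {i m}).mem_nhds (mem_singleton (i m)))
  filter_upwards [this] with j hj
  refine (𝓘.dist_le_of_mem u i n ?_ (𝓘.code_mem u i n)).trans_lt hn
  exact (𝓘.code_preimage u i n).ge (fun m hm => hj m (Finset.mem_range.mpr hm))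

/-- The Moran set is the set of all coded points. -/
theorem range_code (u : ℕ → 𝒜) : range (𝓘.code u) = 𝓘.moranSet u := by
  apply Subset.antisymm
  · rintro _ ⟨i, rfl⟩
    exact mem_iInter.mpr fun n => mem_iUnion.mpr ⟨i, 𝓘.code_mem u i n⟩
  · intro x hx
    have hx' : ∀ n, ∃ i, x ∈ 𝓘.moranInterval u i n := fun n =>
      mem_iUnion.mp (mem_iInter.mp hx n)
    choose w hw using hx'
    refine ⟨fun n => w (n + 1) n, ?_⟩
    have key : ∀ n, x ∈ 𝓘.moranInterval u (fun n => w (n + 1) n) n := by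
      intro n
      have : ∀ m < n, w n m = w (m + 1) m := fun m hm =>
        𝓘.eq_of_mem u (𝓘.moranInterval_anti u _ hm (hw n)) (hw (m + 1)) m m.lt_succ_self
      have h := hw n
      rwa [moranInterval, 𝓘.comp_congr u this] at h
    refine dist_le_zero.mp (ge_of_tendsto'
      (tendsto_pow_atTop_nhds_zero_of_lt_one 𝓘.B_pos.le 𝓘.B_lt_one) fun n => ?_)
    exact 𝓘.dist_le_of_mem u _ n (𝓘.code_mem u _ n) (key n)

instance (ω : ℕ → 𝒜 × Weights K) : IsProbabilityMeasure (𝓘.moranMeasure ω) :=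
  Measure.isProbabilityMeasure_map (𝓘.continuous_code _).measurable.aemeasurable

/-- The defining rule of the Moran measure. -/
theorem moranMeasure_moranInterval (ω : ℕ → 𝒜 × Weights K) (i : ℕ → Fin K) (n : ℕ) :
    𝓘.moranMeasure ω (𝓘.moranInterval (fun m => (ω m).1) i n)
      = ∏ m ∈ Finset.range n, ENNReal.ofReal ((ω m).2.1 (i m)) := by
  rw [moranMeasure, Measure.map_apply (𝓘.continuous_code _).measurable
    (𝓘.isCompact_moranInterval _ i n).isClosed.measurableSet, code_preimage]
  have : {j : ℕ → Fin K | ∀ m < n, j m = i m}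
      = Set.pi (Finset.range n : Set ℕ) (fun m => {i m}) := by
    ext j; simp [Set.mem_pi]
  rw [this, Measure.infinitePi_pi _ (fun _ _ => measurableSet_singleton _)]
  simp only [weightMeasure_singleton]

end IFSFamily

/-- The laws on `𝒜 × Weights K` that are allowed for the fixed distribution `Q` on `𝒜`: the
marginal on `𝒜` is `Q`, and `E(p(i)^(-t)) < ∞` for some `t > 0` and all `i`. The weights may
depend on the systems. -/
structure IsAdmissibleLaw (Q : Measure 𝒜) (P : Measure (𝒜 × Weights K)) : Prop where
  marginal : P.map Prod.fst = Q
  moment : ∃ t : ℝ, 0 < t ∧ ∀ i : Fin K,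
    ∫⁻ l, (ENNReal.ofReal (l.2.1 i)) ^ (-t) ∂P < ∞

end

end RandomMoran

/-!
The random sums `∑ i, a i ^ x` have logarithms whose mean `F x` is continuous and strictly
decreasing in `x`, with `F 0 = log K > 0` and `F 1 < 0`; `D` is its zero
(`exists_integral_log_ratioSum_eq_zero`).

Given `0 < d ≤ D`, the weights are a deterministic function `p u` of the system, bounded away from
zero, with `E (max_i log (p i / a i ^ d)) = 0`. The weights `a i ^ d / ∑ j, a j ^ d` make this mean
equal to `-F d ≤ 0`, and weights that strongly favour one letter make it nonnegative, so that
some mixture has mean zero (`exists_integral_excess_mixedWeight_eq_zero`). Write `X n` for this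
maximum at step `n`. Along every word, the mass of a Moran interval between the levels `m` and `m + N` then
shrinks at least by the power `d` of the ratio of lengths, up to the factor
`exp (X m + ⋯ + X (m + N - 1))`; along the word of maximizing letters it shrinks exactly so.

The `X n` are independent, bounded and centred. Chernoff bounds and the Borel–Cantelli lemma over
all pairs `(m, N)` show that almost surely every such block sum is in absolute value at most
`ε * N + O(log m) + O(1)` for all `ε > 0` (`ae_hasSmallBlockSums`). In the definition of the lower
`Φ`-dimension, `log (R / r)` is at least comparable to `N`, and exceeds `Φ R * |log R|`. For a large
dimension function this is `H R * log |log R|` with `H R → ∞`, while `log |log R|` is at least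
`log m - O(1)`. Hence the factor above is at most a constant times `(R / r) ^ ε`, which gives the
lower bound `d` (`mem_lowerExponents`), and the maximizing word gives the upper bound
(`le_of_mem_lowerExponents`). Strong separation is what allows balls to be compared with Moran
intervals. The measure is doubling since the weights are bounded away from zero.

The Hausdorff dimension comes from the same block estimate for `log (∑ i, a i ^ D)`: covering by
the Moran intervals of one step bounds it from above, and the mass distribution principle for the
weights `a i ^ D / ∑ j, a j ^ D` bounds it from below (`dimH_moranSet`).
-/

namespace RandomMoran

variable {𝒜 : Type*} {K : ℕ}

/-! ### Lengths and masses of Moran intervals, and balls -/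

/-- The product of the weights `(ω m).2` along the first `n` letters of the word `i`. -/
noncomputable def wordWeight (ω : ℕ → 𝒜 × Weights K) (i : ℕ → Fin K) (n : ℕ) : ℝ :=
  ∏ m ∈ Finset.range n, (ω m).2.1 (i m)

theorem wordWeight_pos {ω : ℕ → 𝒜 × Weights K} (h : ∀ m i, 0 < (ω m).2.1 i) (i : ℕ → Fin K)
    (n : ℕ) : 0 < wordWeight ω i n :=
  Finset.prod_pos fun _ _ => h _ _

theorem wordWeight_nonneg (ω : ℕ → 𝒜 × Weights K) (i : ℕ → Fin K) (n : ℕ) :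
    0 ≤ wordWeight ω i n :=
  Finset.prod_nonneg fun m _ => (ω m).2.2.1 _

theorem pow_mul_wordWeight_le {ω : ℕ → 𝒜 × Weights K} {c : ℝ} (hc : 0 ≤ c)
    (h : ∀ m i, c ≤ (ω m).2.1 i) (i : ℕ → Fin K) (m N : ℕ) :
    c ^ N * wordWeight ω i m ≤ wordWeight ω i (m + N) := by
  induction N with
  | zero => simp
  | succ N ih =>
    have hs : wordWeight ω i (m + (N + 1)) = wordWeight ω i (m + N) * (ω (m + N)).2.1 (i (m + N)) :=
      Finset.prod_range_succ _ _
    rw [hs, pow_succ]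
    calc c ^ N * c * wordWeight ω i m = c ^ N * wordWeight ω i m * c := by ring
      _ ≤ _ := mul_le_mul ih (h _ _) hc (wordWeight_nonneg _ _ _)

theorem wordWeight_anti (ω : ℕ → 𝒜 × Weights K) (i : ℕ → Fin K) :
    Antitone (wordWeight ω i) := by
  refine antitone_nat_of_succ_le fun n => ?_
  have hs : wordWeight ω i (n + 1) = wordWeight ω i n * (ω n).2.1 (i n) :=
    Finset.prod_range_succ _ _
  rw [hs]
  refine mul_le_of_le_one_right (wordWeight_nonneg _ _ _) ?_
  rw [← (ω n).2.2.2]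
  exact Finset.single_le_sum (fun j _ => (ω n).2.2.1 j) (Finset.mem_univ _)

namespace IFSFamily

variable [MeasurableSpace 𝒜] (𝓘 : IFSFamily 𝒜 K)

/-- The length of the step `n` Moran interval of the word `i`. -/
noncomputable def len (u : ℕ → 𝒜) (i : ℕ → Fin K) (n : ℕ) : ℝ :=
  ∏ m ∈ Finset.range n, 𝓘.ratio (u m) (i m)

@[simp] theorem len_zero (u : ℕ → 𝒜) (i : ℕ → Fin K) : 𝓘.len u i 0 = 1 := rfl

theorem len_succ (u : ℕ → 𝒜) (i : ℕ → Fin K) (n : ℕ) :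
    𝓘.len u i (n + 1) = 𝓘.len u i n * 𝓘.ratio (u n) (i n) :=
  Finset.prod_range_succ _ _

theorem len_pos (u : ℕ → 𝒜) (i : ℕ → Fin K) (n : ℕ) : 0 < 𝓘.len u i n :=
  𝓘.prod_ratio_pos u i n

theorem ratio_pos (u : 𝒜) (i : Fin K) : 0 < 𝓘.ratio u i :=
  𝓘.A_pos.trans_le (𝓘.le_ratio u i)

theorem A_mul_len_le (u : ℕ → 𝒜) (i : ℕ → Fin K) (n : ℕ) :
    𝓘.A * 𝓘.len u i n ≤ 𝓘.len u i (n + 1) := by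
  rw [len_succ, mul_comm]
  exact mul_le_mul_of_nonneg_left (𝓘.le_ratio _ _) (𝓘.len_pos u i n).le

theorem len_add_le (u : ℕ → 𝒜) (i : ℕ → Fin K) (m N : ℕ) :
    𝓘.len u i (m + N) ≤ 𝓘.B ^ N * 𝓘.len u i m := by
  induction N with
  | zero => simp
  | succ N ih =>
    rw [← add_assoc, len_succ, pow_succ]
    calc 𝓘.len u i (m + N) * 𝓘.ratio (u (m + N)) (i (m + N))
        ≤ 𝓘.B ^ N * 𝓘.len u i m * 𝓘.B :=
          mul_le_mul ih (𝓘.ratio_le _ _) (𝓘.ratio_nonneg _ _)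
            (mul_nonneg (pow_nonneg 𝓘.B_pos.le _) (𝓘.len_pos u i m).le)
      _ = _ := by ring

theorem len_le_pow (u : ℕ → 𝒜) (i : ℕ → Fin K) (n : ℕ) : 𝓘.len u i n ≤ 𝓘.B ^ n :=
  𝓘.prod_ratio_le u i n

theorem exists_first_len_lt (u : ℕ → 𝒜) (i : ℕ → Fin K) {r : ℝ} (hr : 0 < r) :
    ∃ n, 𝓘.len u i n < r ∧ ∀ k < n, r ≤ 𝓘.len u i k := by
  classical
  have h : ∃ n, 𝓘.len u i n < r := by
    obtain ⟨n, hn⟩ := exists_pow_lt_of_lt_one hr 𝓘.B_lt_one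
    exact ⟨n, (𝓘.len_le_pow u i n).trans_lt hn⟩
  exact ⟨Nat.find h, Nat.find_spec h, fun k hk => not_lt.mp (Nat.find_min h hk)⟩

theorem moranInterval_subset_ball (u : ℕ → 𝒜) (i : ℕ → Fin K) {n : ℕ} {r : ℝ}
    (h : 𝓘.len u i n < r) : 𝓘.moranInterval u i n ⊆ Metric.ball (𝓘.code u i) r := by
  rintro _ ⟨a, rfl⟩
  obtain ⟨b, hb⟩ := 𝓘.code_mem u i n
  rw [Metric.mem_ball, ← hb, dist_comp]
  refine lt_of_le_of_lt (mul_le_of_le_one_right (𝓘.len_pos u i n).le ?_) h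
  rw [Subtype.dist_eq, Real.dist_eq, abs_le]
  constructor <;> linarith [a.2.1, a.2.2, b.2.1, b.2.2]

/-- A point of the Moran set closer to `code u i` than the gaps of the first `n` steps lies in the
same step `n` Moran interval. -/
theorem eq_of_code_mem_ball (u : ℕ → 𝒜) (i j : ℕ → Fin K) {n : ℕ} {r : ℝ}
    (h : ∀ k < n, r ≤ 𝓘.τ * 𝓘.len u i k) (hj : 𝓘.code u j ∈ Metric.ball (𝓘.code u i) r) :
    ∀ m < n, j m = i m := by
  intro m
  induction m using Nat.strong_induction_on with
  | _ m ih =>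
    intro hm
    by_contra hne
    obtain ⟨y, hy⟩ := 𝓘.code_mem u j (m + 1)
    obtain ⟨z, hz⟩ := 𝓘.code_mem u i (m + 1)
    rw [Metric.mem_ball, ← hy, ← hz] at hj
    simp only [comp, Function.comp, 𝓘.comp_congr u fun k hk => ih k hk (hk.trans hm)] at hj
    rw [dist_comp] at hj
    have h1 := mul_le_mul_of_nonneg_left (𝓘.separated (u m) _ _ hne y z) (𝓘.len_pos u i m).le
    have h2 := h m hm
    rw [mul_comm] at h2
    exact absurd (h2.trans h1) (not_le.mpr hj)

theorem moranMeasure_real_moranInterval (ω : ℕ → 𝒜 × Weights K) (i : ℕ → Fin K) (n : ℕ) :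
    (𝓘.moranMeasure ω).real (𝓘.moranInterval (fun m => (ω m).1) i n) = wordWeight ω i n := by
  rw [measureReal_def, moranMeasure_moranInterval,
    ← ENNReal.ofReal_prod_of_nonneg fun m _ => (ω m).2.2.1 _,
    ENNReal.toReal_ofReal (Finset.prod_nonneg fun m _ => (ω m).2.2.1 _), wordWeight]

theorem wordWeight_le_measureReal_ball (ω : ℕ → 𝒜 × Weights K) (i : ℕ → Fin K) {n : ℕ} {r : ℝ}
    (h : 𝓘.len (fun m => (ω m).1) i n < r) :
    wordWeight ω i n
      ≤ (𝓘.moranMeasure ω).real (Metric.ball (𝓘.code (fun m => (ω m).1) i) r) := by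
  rw [← moranMeasure_real_moranInterval]
  exact measureReal_mono (𝓘.moranInterval_subset_ball _ i h)

theorem measureReal_ball_le_wordWeight (ω : ℕ → 𝒜 × Weights K) (i : ℕ → Fin K) {n : ℕ} {r : ℝ}
    (h : ∀ k < n, r ≤ 𝓘.τ * 𝓘.len (fun m => (ω m).1) i k) :
    (𝓘.moranMeasure ω).real (Metric.ball (𝓘.code (fun m => (ω m).1) i) r)
      ≤ wordWeight ω i n := by
  have hc : Measurable (𝓘.code fun m => (ω m).1) := (𝓘.continuous_code _).measurable
  rw [← moranMeasure_real_moranInterval, measureReal_def, measureReal_def]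
  refine ENNReal.toReal_mono (measure_ne_top _ _) ?_
  rw [moranMeasure, Measure.map_apply hc Metric.isOpen_ball.measurableSet,
    Measure.map_apply hc (𝓘.isCompact_moranInterval _ i n).isClosed.measurableSet]
  refine measure_mono fun j hj => ?_
  rw [code_preimage]
  exact 𝓘.eq_of_code_mem_ball _ i j h hj

theorem moranMeasure_moranSet (ω : ℕ → 𝒜 × Weights K) :
    𝓘.moranMeasure ω (𝓘.moranSet fun m => (ω m).1) = 1 := by
  have hm : MeasurableSet (𝓘.moranSet fun m => (ω m).1) := by
    rw [← range_code]
    exact (isCompact_range (𝓘.continuous_code _)).isClosed.measurableSet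
  rw [moranMeasure, Measure.map_apply (𝓘.continuous_code _).measurable hm, ← range_code]
  simp

theorem support_moranMeasure_subset (ω : ℕ → 𝒜 × Weights K) :
    (𝓘.moranMeasure ω).support ⊆ range (𝓘.code fun m => (ω m).1) := by
  have hcl : IsClosed (range (𝓘.code fun m => (ω m).1)) :=
    (isCompact_range (𝓘.continuous_code _)).isClosed
  refine Measure.support_subset_of_isClosed hcl ?_
  rw [mem_ae_iff_prob_eq_one hcl.measurableSet, range_code]
  exact 𝓘.moranMeasure_moranSet ω

theorem code_mem_support {ω : ℕ → 𝒜 × Weights K} (h : ∀ m i, 0 < (ω m).2.1 i)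
    (i : ℕ → Fin K) : 𝓘.code (fun m => (ω m).1) i ∈ (𝓘.moranMeasure ω).support := by
  rw [Metric.nhds_basis_ball.mem_measureSupport]
  intro r hr
  obtain ⟨n, hn, -⟩ := 𝓘.exists_first_len_lt (fun m => (ω m).1) i hr
  have := (wordWeight_pos h i n).trans_le (𝓘.wordWeight_le_measureReal_ball ω i hn)
  exact (ENNReal.toReal_pos_iff.mp this).1

/-- The Moran measure is doubling if the weights are bounded away from zero: the levels at which
the Moran intervals have lengths comparable to `R` and to `2 * R / τ` are at bounded distance. -/
theorem isDoubling_moranMeasure {ω : ℕ → 𝒜 × Weights K} {c : ℝ} (hc : 0 < c)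
    (h : ∀ m i, c ≤ (ω m).2.1 i) : IsDoubling (𝓘.moranMeasure ω) := by
  obtain ⟨N, hN⟩ := exists_pow_lt_of_lt_one (half_pos 𝓘.τ_pos) 𝓘.B_lt_one
  refine ⟨(c ^ (N + 1))⁻¹, fun x hx R hR => ?_⟩
  obtain ⟨i, rfl⟩ := 𝓘.support_moranMeasure_subset ω hx
  set u : ℕ → 𝒜 := fun m => (ω m).1
  obtain ⟨m, hm, hm'⟩ := 𝓘.exists_first_len_lt u i hR
  have hτ := 𝓘.τ_pos
  obtain ⟨n, hn, hn'⟩ := 𝓘.exists_first_len_lt u i (r := 2 * R / 𝓘.τ) (by positivity)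
  have h1 := 𝓘.wordWeight_le_measureReal_ball ω i hm
  have h2 : (𝓘.moranMeasure ω).real (Metric.ball (𝓘.code u i) (2 * R)) ≤ wordWeight ω i n :=
    𝓘.measureReal_ball_le_wordWeight ω i fun k hk => by
      have := hn' k hk
      rwa [div_le_iff₀' hτ] at this
  have hmn : m ≤ n + (N + 1) := by
    by_contra! hlt
    have h3 := hm' (n + N) (by omega)
    have h4 := 𝓘.len_add_le u i n N
    have h5 : 𝓘.B ^ N * 𝓘.len u i n < 𝓘.τ / 2 * (2 * R / 𝓘.τ) :=
      mul_lt_mul hN hn.le (𝓘.len_pos u i n) (by positivity)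
    have h6 : 𝓘.τ / 2 * (2 * R / 𝓘.τ) = R := by field_simp
    linarith
  have h7 := pow_mul_wordWeight_le hc.le h i n (N + 1)
  have h8 := wordWeight_anti ω i hmn
  rw [inv_mul_eq_div, le_div_iff₀ (by positivity), mul_comm]
  calc c ^ (N + 1) * _ ≤ c ^ (N + 1) * wordWeight ω i n := by gcongr
    _ ≤ _ := h7.trans (h8.trans h1)

end IFSFamily

/-! ### Block sums and the lower dimension -/

/-- Every block of `N` consecutive terms starting at `m` has a sum of at most
`ε * N + O(log m) + O(1)` in absolute value, for all `ε > 0`. -/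
def HasSmallBlockSums (X : ℕ → ℝ) : Prop :=
  ∀ ε > 0, ∃ L ≥ 0, ∃ C, ∀ m N : ℕ,
    |∑ k ∈ Finset.range N, X (m + k)| ≤ ε * N + L * Real.log (m + 1) + C

theorem HasSmallBlockSums.neg {X : ℕ → ℝ} (h : HasSmallBlockSums X) :
    HasSmallBlockSums fun n => -X n := by
  intro ε hε
  obtain ⟨L, hL, C, hC⟩ := h ε hε
  refine ⟨L, hL, C, fun m N => ?_⟩
  rw [Finset.sum_neg_distrib, abs_neg]
  exact hC m N

namespace IFSFamily

variable [MeasurableSpace 𝒜] (𝓘 : IFSFamily 𝒜 K)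

theorem log_wordWeight_le {ω : ℕ → 𝒜 × Weights K} {d : ℝ} {X : ℕ → ℝ}
    (hpos : ∀ m i, 0 < (ω m).2.1 i)
    (hX : ∀ m i, Real.log ((ω m).2.1 i) ≤ d * Real.log (𝓘.ratio (ω m).1 i) + X m)
    (i : ℕ → Fin K) (m N : ℕ) :
    Real.log (wordWeight ω i (m + N)) - Real.log (wordWeight ω i m)
      ≤ d * (Real.log (𝓘.len (fun m => (ω m).1) i (m + N))
        - Real.log (𝓘.len (fun m => (ω m).1) i m)) + ∑ k ∈ Finset.range N, X (m + k) := by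
  induction N with
  | zero => simp
  | succ N ih =>
    have hs : wordWeight ω i (m + (N + 1)) = wordWeight ω i (m + N) * (ω (m + N)).2.1 (i (m + N)) :=
      Finset.prod_range_succ _ _
    rw [hs, ← add_assoc, len_succ, Real.log_mul (wordWeight_pos hpos _ _).ne' (hpos _ _).ne',
      Real.log_mul (𝓘.len_pos _ _ _).ne' (𝓘.ratio_pos _ _).ne', Finset.sum_range_succ]
    linarith [hX (m + N) (i (m + N))]

theorem log_wordWeight_eq {ω : ℕ → 𝒜 × Weights K} {d : ℝ} {X : ℕ → ℝ}
    (hpos : ∀ m i, 0 < (ω m).2.1 i) {i : ℕ → Fin K}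
    (hX : ∀ m, Real.log ((ω m).2.1 (i m)) = d * Real.log (𝓘.ratio (ω m).1 (i m)) + X m)
    (n : ℕ) :
    Real.log (wordWeight ω i n)
      = d * Real.log (𝓘.len (fun m => (ω m).1) i n) + ∑ k ∈ Finset.range n, X k := by
  induction n with
  | zero => simp [wordWeight]
  | succ n ih =>
    have hs : wordWeight ω i (n + 1) = wordWeight ω i n * (ω n).2.1 (i n) :=
      Finset.prod_range_succ _ _
    rw [hs, len_succ, Real.log_mul (wordWeight_pos hpos _ _).ne' (hpos _ _).ne',
      Real.log_mul (𝓘.len_pos _ _ _).ne' (𝓘.ratio_pos _ _).ne', Finset.sum_range_succ]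
    linarith [hX n]

theorem log_inv_B_pos : 0 < -Real.log 𝓘.B := neg_pos.mpr (Real.log_neg 𝓘.B_pos 𝓘.B_lt_one)

theorem log_len_add_le (u : ℕ → 𝒜) (i : ℕ → Fin K) (m N : ℕ) :
    Real.log (𝓘.len u i (m + N)) ≤ Real.log (𝓘.len u i m) - N * (-Real.log 𝓘.B) := by
  have h := Real.log_le_log (𝓘.len_pos u i _) (𝓘.len_add_le u i m N)
  rw [Real.log_mul (pow_pos 𝓘.B_pos _).ne' (𝓘.len_pos u i m).ne', Real.log_pow] at h
  linarith

theorem log_len_le (u : ℕ → 𝒜) (i : ℕ → Fin K) (n : ℕ) :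
    Real.log (𝓘.len u i n) ≤ -(n * (-Real.log 𝓘.B)) := by
  have h := 𝓘.log_len_add_le u i 0 n
  rw [zero_add, len_zero, Real.log_one] at h
  linarith

/-- If `p i ≤ a i ^ d * exp X` holds for all weights, with small block sums of `X`, then every
exponent below `d` is admitted in the lower `Φ`-dimension. The radii `R > r` correspond to levels
`m < m + N`, and the largeness of `Φ` makes `log m` negligible against `log (R / r)`. -/
theorem mem_lowerExponents {ω : ℕ → 𝒜 × Weights K} {d : ℝ} {X : ℕ → ℝ}
    (hpos : ∀ m i, 0 < (ω m).2.1 i)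
    (hX : ∀ m i, Real.log ((ω m).2.1 i) ≤ d * Real.log (𝓘.ratio (ω m).1 i) + X m)
    (hg : HasSmallBlockSums X) {Φ : ℝ → ℝ} (hΦ : IsLargeDimensionFunction Φ) {ε : ℝ}
    (hε : 0 < ε) (hεd : ε < d) : d - ε ∈ lowerExponents Φ (𝓘.moranMeasure ω) := by
  set b := -Real.log 𝓘.B with hb
  have hbpos : 0 < b := 𝓘.log_inv_B_pos
  have hτ := 𝓘.τ_pos
  have hA := 𝓘.A_pos
  obtain ⟨L, hL, C, hC⟩ := hg (ε / 2 * b) (by positivity)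
  obtain ⟨H, hH, hΦH⟩ := hΦ.large
  have hev : ∀ᶠ R in 𝓝[>] (0 : ℝ), Φ R = H R * (Real.log |Real.log R| / |Real.log R|) ∧
      2 * L / ε ≤ H R ∧ -Real.log 𝓘.τ ≤ H R ∧ Real.log R ≤ -Real.exp 1 := by
    filter_upwards [hΦH, hH.eventually_ge_atTop (2 * L / ε),
      hH.eventually_ge_atTop (-Real.log 𝓘.τ),
      Real.tendsto_log_nhdsGT_zero.eventually_le_atBot (-Real.exp 1)] with R h1 h2 h3 h4
    exact ⟨h1, h2, h3, h4⟩
  rw [eventually_nhdsWithin_iff, Metric.eventually_nhds_iff] at hev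
  obtain ⟨δ, hδ, hev⟩ := hev
  -- The constants lost in comparing balls with intervals and `log m` with `log |log R|`.
  set c₀ := (d - ε / 2) * Real.log (𝓘.A * 𝓘.τ) - L * Real.log (1 / b + 2) - C with hc₀
  refine ⟨δ / 2, by positivity, Real.exp c₀, Real.exp_pos _, ?_⟩
  intro r R hr hrR _ hR hRδ x hx
  obtain ⟨i, rfl⟩ := 𝓘.support_moranMeasure_subset ω hx
  set u : ℕ → 𝒜 := fun m => (ω m).1 with hu
  obtain ⟨hΦR, hH1, hH2, hlogR⟩ := hev (y := R)
    (by rw [Real.dist_eq, sub_zero, abs_of_pos hR]; linarith) hR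
  set ℓ := |Real.log R| with hℓ
  have hexp1 : (1 : ℝ) < Real.exp 1 := by have := Real.add_one_le_exp (1 : ℝ); linarith
  have hℓR : ℓ = -Real.log R := abs_of_neg (by linarith)
  have hℓe : Real.exp 1 ≤ ℓ := by linarith
  have hℓpos : 0 < ℓ := by linarith
  have hlogℓ : 1 ≤ Real.log ℓ := (Real.le_log_iff_exp_le hℓpos).mpr hℓe
  set ρ := Real.log (R / r) with hρ
  have hρ' : ρ = Real.log R - Real.log r := Real.log_div hR.ne' hr.ne'
  have hρH : H R * Real.log ℓ ≤ ρ := by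
    have h1 := Real.log_lt_log hr hrR
    rw [Real.log_rpow hR] at h1
    have h2 : Φ R * ℓ = H R * Real.log ℓ := by
      rw [hΦR]; field_simp
    rw [hρ', ← h2, hℓR]
    linarith
  have hHnn : 0 ≤ H R := le_trans (by positivity) hH1
  have hρτ : -Real.log 𝓘.τ ≤ ρ :=
    (hH2.trans (le_mul_of_one_le_right hHnn hlogℓ)).trans hρH
  -- The interval of level `m` lies in `B(x, R)`, and the interval of level `n` contains all points
  -- of the Moran set in `B(x, r)`.
  obtain ⟨m, hm, hm'⟩ := 𝓘.exists_first_len_lt u i hR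
  obtain ⟨n, hn, hn'⟩ := 𝓘.exists_first_len_lt u i (r := r / 𝓘.τ) (by positivity)
  have hup := 𝓘.wordWeight_le_measureReal_ball ω i hm
  have hlow : (𝓘.moranMeasure ω).real (Metric.ball (𝓘.code u i) r) ≤ wordWeight ω i n :=
    𝓘.measureReal_ball_le_wordWeight ω i fun k hk => by
      have := hn' k hk
      rwa [div_le_iff₀' hτ] at this
  have hlogn : Real.log (𝓘.len u i n) < Real.log r - Real.log 𝓘.τ := by
    rw [← Real.log_div hr.ne' hτ.ne']
    exact Real.log_lt_log (𝓘.len_pos u i n) hn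
  obtain ⟨m, rfl⟩ : ∃ m', m = m' + 1 := by
    refine ⟨m - 1, ?_⟩
    rcases Nat.eq_zero_or_pos m with rfl | h
    · rw [len_zero] at hm
      have := Real.log_pos hm
      linarith
    · omega
  have hRm : Real.log R ≤ Real.log (𝓘.len u i m) :=
    Real.log_le_log hR (hm' m m.lt_succ_self)
  have hmn : m + 1 ≤ n := by
    by_contra! hlt
    have := Real.log_le_log hR (hm' n hlt)
    linarith
  obtain ⟨N, rfl⟩ := Nat.exists_eq_add_of_le hmn
  have hlogm : Real.log 𝓘.A + Real.log R ≤ Real.log (𝓘.len u i (m + 1)) := by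
    have h := Real.log_le_log (mul_pos hA (𝓘.len_pos u i m)) (𝓘.A_mul_len_le u i m)
    rw [Real.log_mul hA.ne' (𝓘.len_pos u i m).ne'] at h
    linarith
  set Δ := Real.log (𝓘.len u i (m + 1)) - Real.log (𝓘.len u i (m + 1 + N)) with hΔ
  have hΔρ : ρ + Real.log (𝓘.A * 𝓘.τ) ≤ Δ := by
    rw [Real.log_mul hA.ne' hτ.ne']
    linarith
  have hN : N * b ≤ Δ := by
    have := 𝓘.log_len_add_le u i (m + 1) N
    linarith
  have hW := 𝓘.log_wordWeight_le hpos hX i (m + 1) N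
  have hS := (le_abs_self _).trans (hC (m + 1) N)
  have hmlog : Real.log ((m + 1 : ℕ) + 1) ≤ Real.log ℓ + Real.log (1 / b + 2) := by
    rw [← Real.log_mul hℓpos.ne' (by positivity)]
    refine Real.log_le_log (by positivity) ?_
    have h1 := 𝓘.log_len_le u i m
    have h2 : m * b ≤ ℓ := by linarith
    have h3 : (m : ℝ) ≤ ℓ * (1 / b) := by
      rw [mul_one_div, le_div_iff₀ hbpos]; exact h2
    push_cast
    linarith
  have hLρ : L * Real.log ℓ ≤ ε / 2 * ρ := by
    have h1 : 2 * L / ε * Real.log ℓ ≤ ρ :=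
      (mul_le_mul_of_nonneg_right hH1 (by linarith)).trans hρH
    have h2 : L * Real.log ℓ = ε / 2 * (2 * L / ε * Real.log ℓ) := by field_simp
    rw [h2]
    exact mul_le_mul_of_nonneg_left h1 (by positivity)
  have key : c₀ + (d - ε) * ρ
      ≤ Real.log (wordWeight ω i (m + 1)) - Real.log (wordWeight ω i (m + 1 + N)) := by
    have h1 : ε / 2 * b * N ≤ ε / 2 * Δ := by
      have := mul_le_mul_of_nonneg_left hN (by positivity : 0 ≤ ε / 2)
      linarith
    have h2 : L * Real.log ((m + 1 : ℕ) + 1) ≤ ε / 2 * ρ + L * Real.log (1 / b + 2) := by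
      have := mul_le_mul_of_nonneg_left hmlog hL
      linarith
    have h3 := mul_le_mul_of_nonneg_left hΔρ (by linarith : 0 ≤ d - ε / 2)
    rw [hc₀]
    linarith
  have hball : 0 < (𝓘.moranMeasure ω).real (Metric.ball (𝓘.code u i) r) :=
    ENNReal.toReal_pos
      ((Metric.nhds_basis_ball.mem_measureSupport.mp hx r hr).ne') (measure_ne_top _ _)
  have hw1 := wordWeight_pos hpos i (m + 1)
  have hw2 := wordWeight_pos hpos i (m + 1 + N)
  calc Real.exp c₀ * (R / r) ^ (d - ε) = Real.exp (c₀ + (d - ε) * ρ) := by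
        rw [Real.rpow_def_of_pos (by positivity), Real.exp_add, mul_comm ρ]
    _ ≤ wordWeight ω i (m + 1) / wordWeight ω i (m + 1 + N) := by
        rw [← Real.log_div hw1.ne' hw2.ne'] at key
        exact (Real.le_log_iff_exp_le (by positivity)).mp key
    _ ≤ _ := div_le_div₀ measureReal_nonneg hup hball hlow

/-- A word along which `p (i m) = a (i m) ^ d * exp (X m)`, with small block sums of `X`, gives a
point of local dimension `d`; so no exponent above `d` is admitted. -/
theorem le_of_mem_lowerExponents {ω : ℕ → 𝒜 × Weights K} {d : ℝ} {X : ℕ → ℝ}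
    (hpos : ∀ m i, 0 < (ω m).2.1 i) {i : ℕ → Fin K}
    (hX : ∀ m, Real.log ((ω m).2.1 (i m)) = d * Real.log (𝓘.ratio (ω m).1 (i m)) + X m)
    (hg : HasSmallBlockSums X) {Φ : ℝ → ℝ} (hΦ : IsDimensionFunction Φ) {e : ℝ}
    (he : e ∈ lowerExponents Φ (𝓘.moranMeasure ω)) : e ≤ d := by
  by_contra! hlt
  obtain ⟨C₁, hC₁, C₂, hC₂, h⟩ := he
  set b := -Real.log 𝓘.B with hb
  have hbpos : 0 < b := 𝓘.log_inv_B_pos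
  set u : ℕ → 𝒜 := fun m => (ω m).1 with hu
  set R := min C₁ (1 / 2) with hR
  have hRpos : 0 < R := by positivity
  have hR1 : R < 1 := (min_le_right _ _).trans_lt (by norm_num)
  have hΦR := hΦ.nonneg R ⟨hRpos, hR1⟩
  have hRΦ : R ^ (1 + Φ R) ≤ R := by
    conv_rhs => rw [← Real.rpow_one R]
    exact Real.rpow_le_rpow_of_exponent_ge hRpos hR1.le (by linarith)
  have hRΦpos : 0 < R ^ (1 + Φ R) := Real.rpow_pos_of_pos hRpos _
  obtain ⟨L, hL, C, hC⟩ := hg ((e - d) / 2 * b) (by have := sub_pos.mpr hlt; positivity)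
  have hsmall : ∀ᶠ n : ℕ in atTop, 𝓘.B ^ n < R ^ (1 + Φ R) / 2 :=
    (tendsto_pow_atTop_nhds_zero_of_lt_one 𝓘.B_pos.le 𝓘.B_lt_one).eventually_lt_const
      (by positivity)
  -- Compare the ball of radius `2 * len n` with the step `n` interval, for all large `n`.
  have hbound : ∀ᶠ n : ℕ in atTop,
      Real.log C₂ + e * (Real.log R - Real.log 2) - C ≤ -((e - d) / 2 * b * n) := by
    filter_upwards [hsmall] with n hn
    have hlen := 𝓘.len_pos u i n
    have hle := 𝓘.len_le_pow u i n
    have hball := 𝓘.wordWeight_le_measureReal_ball ω i (n := n)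
      (r := 2 * 𝓘.len u i n) (by linarith)
    have hw := wordWeight_pos hpos i n
    have h1 := h (2 * 𝓘.len u i n) R (by positivity) (by linarith) hRΦ hRpos (min_le_left _ _)
      _ (𝓘.code_mem_support hpos i)
    have h2 : C₂ * (R / (2 * 𝓘.len u i n)) ^ e ≤ 1 / wordWeight ω i n :=
      h1.trans (div_le_div₀ zero_le_one measureReal_le_one hw hball)
    have h3 := Real.log_le_log (by positivity) h2
    rw [Real.log_mul hC₂.ne' (by positivity), Real.log_rpow (by positivity),
      Real.log_div hRpos.ne' (by positivity), Real.log_mul two_ne_zero hlen.ne', one_div,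
      Real.log_inv, 𝓘.log_wordWeight_eq hpos hX n] at h3
    have h4 := neg_le_of_abs_le (hC 0 n)
    simp only [zero_add, Nat.cast_zero, Real.log_one, mul_zero, add_zero] at h4
    have h5 := mul_le_mul_of_nonneg_left (𝓘.log_len_le u i n) (sub_pos.mpr hlt).le
    simp only [← hu, ← hb] at h3 h5
    linarith
  have hlim : Tendsto (fun n : ℕ => -((e - d) / 2 * b * (n : ℝ))) atTop atBot :=
    tendsto_neg_atTop_atBot.comp (tendsto_natCast_atTop_atTop.const_mul_atTop
      (by have := sub_pos.mpr hlt; positivity))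
  obtain ⟨n, h1, h2⟩ := (hbound.and (hlim.eventually_lt_atBot
    (Real.log C₂ + e * (Real.log R - Real.log 2) - C))).exists
  linarith

theorem lowerPhiDim_moranMeasure {ω : ℕ → 𝒜 × Weights K} {d : ℝ} (hd : 0 < d) {X : ℕ → ℝ}
    (hpos : ∀ m i, 0 < (ω m).2.1 i)
    (hX : ∀ m i, Real.log ((ω m).2.1 i) ≤ d * Real.log (𝓘.ratio (ω m).1 i) + X m)
    (hX' : ∀ m, ∃ i, Real.log ((ω m).2.1 i) = d * Real.log (𝓘.ratio (ω m).1 i) + X m)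
    (hg : HasSmallBlockSums X) {Φ : ℝ → ℝ} (hΦ : IsLargeDimensionFunction Φ) :
    lowerPhiDim Φ (𝓘.moranMeasure ω) = (d : EReal) := by
  choose i hi using hX'
  apply le_antisymm
  · exact iSup₂_le fun e he => EReal.coe_le_coe_iff.mpr
      (𝓘.le_of_mem_lowerExponents hpos hi hg hΦ.toIsDimensionFunction he)
  · refine le_of_forall_lt fun c hc => ?_
    obtain ⟨q, hcq, hqd⟩ := EReal.lt_iff_exists_real_btwn.mp hc
    have hqd' : q < d := EReal.coe_lt_coe_iff.mp hqd
    have hmax : max q (d / 2) < d := max_lt hqd' (by linarith)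
    have hmem := 𝓘.mem_lowerExponents hpos hX hg hΦ (ε := d - max q (d / 2)) (by linarith)
      (by linarith [le_max_right q (d / 2)])
    rw [sub_sub_cancel] at hmem
    exact hcq.trans_le ((EReal.coe_le_coe_iff.mpr (le_max_left q (d / 2))).trans
      (le_iSup₂ (f := fun e (_ : e ∈ lowerExponents Φ (𝓘.moranMeasure ω)) => (e : EReal)) _ hmem))

end IFSFamily

/-! ### Block sums of independent centred variables -/

open ProbabilityTheory in
/-- Chernoff bounds for the block sums and the Borel–Cantelli lemma over all pairs `(m, N)`. -/
theorem ae_exists_blockSum_le {Ω : Type*} [MeasurableSpace Ω] (μ : Measure Ω)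
    [IsProbabilityMeasure μ] {f : Ω → ℝ} (hf : Measurable f) {b : ℝ} (hb : ∀ᵐ x ∂μ, |f x| ≤ b)
    (h0 : ∫ x, f x ∂μ = 0) {ε : ℝ} (hε : 0 < ε) :
    ∃ L ≥ 0, ∀ᵐ ω ∂(Measure.infinitePi fun _ : ℕ => μ), ∃ C, ∀ m N : ℕ,
      ∑ k ∈ Finset.range N, f (ω (m + k)) ≤ ε * N + L * Real.log (m + 1) + C := by
  obtain ⟨c, hc⟩ : ∃ c, HasSubgaussianMGF f c μ :=
    ⟨_, hasSubgaussianMGF_of_mem_Icc_of_integral_eq_zero hf.aemeasurable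
      (hb.mono fun x hx => abs_le.mp hx) h0⟩
  set Pr := Measure.infinitePi fun _ : ℕ => μ
  have hsub : ∀ n : ℕ, HasSubgaussianMGF (fun ω : ℕ → Ω => f (ω n)) c Pr := fun n => by
    have h := measurePreserving_eval_infinitePi (fun _ : ℕ => μ) n
    exact HasSubgaussianMGF.of_map (Y := fun ω : ℕ → Ω => ω n) h.measurable.aemeasurable
      (by rw [h.map_eq]; exact hc)
  have hind : iIndepFun (fun (n : ℕ) (ω : ℕ → Ω) => f (ω n)) Pr := iIndepFun_infinitePi fun _ => hf
  -- With this `s` the exponent `c * s ^ 2 / 2` of the Chernoff bound is at most half of `s * ε`;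
  -- `L` is chosen to make the bounds summable over `m`.
  set s : ℝ := ε / (c + 1) with hs
  have hs0 : 0 < s := by positivity
  have hcs : c * s ≤ ε := by
    rw [hs, mul_div_assoc', div_le_iff₀ (by positivity)]
    nlinarith [c.coe_nonneg]
  set L := 2 / s with hL
  refine ⟨L, by positivity, ?_⟩
  set E : ℕ × ℕ → Set (ℕ → Ω) := fun q =>
    {ω | ε * q.2 + L * Real.log (q.1 + 1) ≤ ∑ k ∈ Finset.range q.2, f (ω (q.1 + k))} with hE
  set θ : ℝ := Real.exp (-(s * ε / 2)) with hθ
  have hbound : ∀ q, Pr.real (E q) ≤ 1 / ((q.1 : ℝ) + 1) ^ 2 * θ ^ q.2 := by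
    rintro ⟨m, N⟩
    have hsum := HasSubgaussianMGF.sum_of_iIndepFun (s := Finset.range N)
      (hind.precomp (add_right_injective m)) (c := fun _ => c) fun k _ => hsub (m + k)
    have h1 := measure_ge_le_exp_mul_mgf (ε * N + L * Real.log (m + 1)) hs0.le
      (hsum.integrable_exp_mul s)
    refine h1.trans ((mul_le_mul_of_nonneg_left (hsum.mgf_le s) (Real.exp_pos _).le).trans ?_)
    have hm : (0 : ℝ) < m + 1 := by positivity
    have h2 : 1 / ((m : ℝ) + 1) ^ 2 * θ ^ N
        = Real.exp (-(2 * Real.log (m + 1)) + N * (-(s * ε / 2))) := by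
      rw [Real.exp_add, Real.exp_nat_mul, Real.exp_neg, one_div]
      congr 2
      rw [two_mul, Real.exp_add, Real.exp_log hm, sq]
    rw [h2, ← Real.exp_add, Real.exp_le_exp]
    have h3 : s * (L * Real.log (m + 1)) = 2 * Real.log (m + 1) := by
      rw [hL]; field_simp
    have h4 : (N : ℝ) * s * (c * s) ≤ N * s * ε := mul_le_mul_of_nonneg_left hcs (by positivity)
    simp only [Finset.sum_const, Finset.card_range, nsmul_eq_mul]
    push_cast
    linarith
  have hθ1 : θ < 1 := Real.exp_lt_one_iff.mpr (by linarith [mul_pos hs0 hε])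
  have hsummable : Summable fun q : ℕ × ℕ => 1 / ((q.1 : ℝ) + 1) ^ 2 * θ ^ q.2 := by
    have h1 : Summable fun m : ℕ => 1 / ((m : ℝ) + 1) ^ 2 := by
      have := (summable_nat_add_iff 1).mpr
        (Real.summable_one_div_nat_pow.mpr (one_lt_two : 1 < 2))
      simpa using this
    exact h1.mul_of_nonneg (summable_geometric_of_lt_one (Real.exp_pos _).le hθ1)
      (fun _ => by positivity) (fun _ => by positivity)
  have hfin : ∑' q, Pr (E q) ≠ ∞ := by
    refine ne_top_of_le_ne_top hsummable.tsum_ofReal_ne_top (ENNReal.tsum_le_tsum fun q => ?_)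
    rw [← ofReal_measureReal]
    exact ENNReal.ofReal_le_ofReal (hbound q)
  filter_upwards [ae_finite_setOfPred_mem hfin] with ω hω
  refine ⟨∑ q ∈ hω.toFinset, |∑ k ∈ Finset.range q.2, f (ω (q.1 + k))|, fun m N => ?_⟩
  have hlog : 0 ≤ L * Real.log ((m : ℝ) + 1) :=
    mul_nonneg (by positivity) (Real.log_nonneg (by linarith [m.cast_nonneg (α := ℝ)]))
  by_cases hmem : ω ∈ E (m, N)
  · have h1 := Finset.single_le_sum
      (f := fun q : ℕ × ℕ => |∑ k ∈ Finset.range q.2, f (ω (q.1 + k))|)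
      (fun q _ => abs_nonneg _) (hω.mem_toFinset.mpr hmem)
    have h2 := le_abs_self (∑ k ∈ Finset.range N, f (ω (m + k)))
    have h3 : 0 ≤ ε * (N : ℝ) := by positivity
    simp only at h1
    linarith
  · have h1 : ∑ k ∈ Finset.range N, f (ω (m + k)) < ε * N + L * Real.log (m + 1) :=
      not_le.mp hmem
    have h2 : 0 ≤ ∑ q ∈ hω.toFinset, |∑ k ∈ Finset.range q.2, f (ω (q.1 + k))| :=
      Finset.sum_nonneg fun _ _ => abs_nonneg _
    linarith

theorem ae_hasSmallBlockSums {Ω : Type*} [MeasurableSpace Ω] (μ : Measure Ω)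
    [IsProbabilityMeasure μ] {f : Ω → ℝ} (hf : Measurable f) {b : ℝ} (hb : ∀ᵐ x ∂μ, |f x| ≤ b)
    (h0 : ∫ x, f x ∂μ = 0) :
    ∀ᵐ ω ∂(Measure.infinitePi fun _ : ℕ => μ), HasSmallBlockSums fun n => f (ω n) := by
  have hε : ∀ j : ℕ, (0 : ℝ) < 1 / (j + 1) := fun j => by positivity
  choose L₁ hL₁ h₁ using fun j => ae_exists_blockSum_le μ hf hb h0 (hε j)
  choose L₂ hL₂ h₂ using fun j => ae_exists_blockSum_le μ hf.neg
    (b := b) (by simpa using hb) (by simpa [integral_neg] using h0) (hε j)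
  filter_upwards [ae_all_iff.mpr h₁, ae_all_iff.mpr h₂] with ω hω₁ hω₂ ε hε
  obtain ⟨j, hj⟩ := exists_nat_one_div_lt hε
  obtain ⟨C₁, hC₁⟩ := hω₁ j
  obtain ⟨C₂, hC₂⟩ := hω₂ j
  refine ⟨max (L₁ j) (L₂ j), le_max_of_le_left (hL₁ j), max C₁ C₂, fun m N => ?_⟩
  have hlog : 0 ≤ Real.log ((m : ℝ) + 1) :=
    Real.log_nonneg (by linarith [m.cast_nonneg (α := ℝ)])
  have hN : 1 / ((j : ℝ) + 1) * N ≤ ε * N := mul_le_mul_of_nonneg_right hj.le N.cast_nonneg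
  have h1 := hC₁ m N
  have h2 := hC₂ m N
  simp only [Pi.neg_apply, Finset.sum_neg_distrib] at h2
  have h3 := mul_le_mul_of_nonneg_right (le_max_left (L₁ j) (L₂ j)) hlog
  have h4 := mul_le_mul_of_nonneg_right (le_max_right (L₁ j) (L₂ j)) hlog
  have h5 := le_max_left C₁ C₂
  have h6 := le_max_right C₁ C₂
  rw [abs_le]
  constructor <;> linarith

/-! ### Hausdorff dimension of the Moran set -/

namespace IFSFamily

variable [MeasurableSpace 𝒜] (𝓘 : IFSFamily 𝒜 K)

theorem one_le_natCast_K (𝓘 : IFSFamily 𝒜 K) : (1 : ℝ) ≤ K := by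
  exact_mod_cast one_le_two.trans 𝓘.two_le

theorem natCast_K_pos (𝓘 : IFSFamily 𝒜 K) : (0 : ℝ) < K :=
  zero_lt_one.trans_le 𝓘.one_le_natCast_K

/-- A distinguished letter. -/
def first : Fin K := ⟨0, zero_lt_two.trans_le 𝓘.two_le⟩

/-- The sum `∑ i, a i ^ x` of the powers of the ratios of one system. -/
noncomputable def ratioSum (x : ℝ) (u : 𝒜) : ℝ := ∑ i, 𝓘.ratio u i ^ x

theorem A_le_B : 𝓘.A ≤ 𝓘.B :=
  (le_mul_of_one_le_left 𝓘.A_pos.le 𝓘.one_le_natCast_K).trans 𝓘.KA_le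

theorem rpow_A_le_ratioSum {x : ℝ} (hx : 0 ≤ x) (u : 𝒜) : 𝓘.A ^ x ≤ 𝓘.ratioSum x u :=
  (Real.rpow_le_rpow 𝓘.A_pos.le (𝓘.le_ratio u 𝓘.first) hx).trans
    (Finset.single_le_sum (f := fun i => 𝓘.ratio u i ^ x)
      (fun i _ => Real.rpow_nonneg (𝓘.ratio_nonneg u i) x) (Finset.mem_univ 𝓘.first))

theorem ratioSum_pos (x : ℝ) (u : 𝒜) : 0 < 𝓘.ratioSum x u :=
  Finset.sum_pos (fun i _ => Real.rpow_pos_of_pos (𝓘.ratio_pos u i) x)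
    ⟨𝓘.first, Finset.mem_univ _⟩

theorem ratioSum_le {x : ℝ} (hx : 0 ≤ x) (u : 𝒜) : 𝓘.ratioSum x u ≤ K := by
  calc 𝓘.ratioSum x u ≤ ∑ _i : Fin K, (1 : ℝ) := Finset.sum_le_sum fun i _ =>
        Real.rpow_le_one (𝓘.ratio_nonneg u i) ((𝓘.ratio_le u i).trans 𝓘.B_lt_one.le) hx
    _ = K := by simp

theorem ratioSum_le_rpow_mul {x y : ℝ} (hxy : x ≤ y) (u : 𝒜) :
    𝓘.ratioSum y u ≤ 𝓘.B ^ (y - x) * 𝓘.ratioSum x u := by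
  rw [ratioSum, ratioSum, Finset.mul_sum]
  refine Finset.sum_le_sum fun i _ => ?_
  have h : 𝓘.ratio u i ^ y = 𝓘.ratio u i ^ (y - x) * 𝓘.ratio u i ^ x := by
    rw [← Real.rpow_add (𝓘.ratio_pos u i)]; congr 1; ring
  rw [h]
  exact mul_le_mul_of_nonneg_right (Real.rpow_le_rpow (𝓘.ratio_nonneg u i) (𝓘.ratio_le u i)
    (sub_nonneg.mpr hxy)) (Real.rpow_nonneg (𝓘.ratio_nonneg u i) x)

/-- The weights `a i ^ x / ∑ j, a j ^ x`. -/
noncomputable def gibbsWeight (x : ℝ) (u : 𝒜) : Weights K :=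
  ⟨fun i => 𝓘.ratio u i ^ x / 𝓘.ratioSum x u,
    fun i => div_nonneg (Real.rpow_nonneg (𝓘.ratio_nonneg u i) x) (𝓘.ratioSum_pos x u).le, by
      rw [← Finset.sum_div]; exact div_self (𝓘.ratioSum_pos x u).ne'⟩

theorem gibbsWeight_pos (x : ℝ) (u : 𝒜) (i : Fin K) : 0 < (𝓘.gibbsWeight x u).1 i :=
  div_pos (Real.rpow_pos_of_pos (𝓘.ratio_pos u i) x) (𝓘.ratioSum_pos x u)

theorem log_gibbsWeight (x : ℝ) (u : 𝒜) (i : Fin K) :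
    Real.log ((𝓘.gibbsWeight x u).1 i)
      = x * Real.log (𝓘.ratio u i) - Real.log (𝓘.ratioSum x u) := by
  have h := 𝓘.ratio_pos u i
  rw [gibbsWeight, Real.log_div (Real.rpow_pos_of_pos h x).ne' (𝓘.ratioSum_pos x u).ne',
    Real.log_rpow h]

/-- Mass distribution principle: if `p i ≤ a i ^ d * exp X` with small block sums of `X`, then
the Moran measure of a set is at most a constant times the power `d - ε` of its diameter. -/
theorem ofReal_sub_le_dimH_moranSet {ω : ℕ → 𝒜 × Weights K} {d : ℝ} {X : ℕ → ℝ}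
    (hpos : ∀ m i, 0 < (ω m).2.1 i)
    (hX : ∀ m i, Real.log ((ω m).2.1 i) ≤ d * Real.log (𝓘.ratio (ω m).1 i) + X m)
    (hg : HasSmallBlockSums X) {ε : ℝ} (hε : 0 < ε) (hεd : ε < d) :
    ENNReal.ofReal (d - ε) ≤ dimH (𝓘.moranSet fun m => (ω m).1) := by
  set u : ℕ → 𝒜 := fun m => (ω m).1 with hu
  set s := d - ε with hs
  have hs0 : 0 < s := sub_pos.mpr hεd
  have hτ := 𝓘.τ_pos
  set b := -Real.log 𝓘.B with hb
  have hbpos : 0 < b := 𝓘.log_inv_B_pos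
  obtain ⟨L, -, C, hC⟩ := hg (ε * b) (by positivity)
  set M : ℝ := Real.exp C / 𝓘.τ ^ s with hM
  have hMpos : 0 < M := by positivity
  have hball : ∀ i r, 0 < r →
      (𝓘.moranMeasure ω).real (Metric.ball (𝓘.code u i) r) ≤ M * r ^ s := by
    intro i r hr
    obtain ⟨n, hn, hn'⟩ := 𝓘.exists_first_len_lt u i (r := r / 𝓘.τ) (by positivity)
    have h1 : (𝓘.moranMeasure ω).real (Metric.ball (𝓘.code u i) r) ≤ wordWeight ω i n :=
      𝓘.measureReal_ball_le_wordWeight ω i fun k hk => by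
        have := hn' k hk
        rwa [div_le_iff₀' hτ] at this
    have hlen := 𝓘.len_pos u i n
    have h2 := 𝓘.log_wordWeight_le hpos hX i 0 n
    have h3 := (le_abs_self _).trans (hC 0 n)
    have h4 := mul_le_mul_of_nonneg_left (𝓘.log_len_le u i n) hε.le
    simp only [zero_add, len_zero, Real.log_one, Nat.cast_zero, mul_zero, add_zero, sub_zero,
      wordWeight, Finset.range_zero, Finset.prod_empty, ← hu, ← hb] at h2 h3 h4
    have h5 : Real.log (wordWeight ω i n) ≤ C + Real.log (𝓘.len u i n) * s := by
      rw [wordWeight]; linarith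
    rw [Real.log_le_iff_le_exp (wordWeight_pos hpos i n), Real.exp_add,
      ← Real.rpow_def_of_pos hlen] at h5
    calc _ ≤ Real.exp C * 𝓘.len u i n ^ s := h1.trans h5
      _ ≤ Real.exp C * (r / 𝓘.τ) ^ s := by gcongr
      _ = M * r ^ s := by rw [Real.div_rpow hr.le hτ.le, hM]; ring
  have hset : ∀ U : Set unitInterval,
      𝓘.moranMeasure ω U ≤ ENNReal.ofReal M * Metric.ediam U ^ s := by
    intro U
    by_cases hUF : ∃ i, 𝓘.code u i ∈ U
    · obtain ⟨i, hi⟩ := hUF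
      have hbdd : Metric.ediam U ≠ ∞ :=
        (isCompact_univ.isBounded.subset (subset_univ U)).ediam_ne_top
      have h1 : ∀ r, Metric.diam U < r → (𝓘.moranMeasure ω).real U ≤ M * r ^ s := fun r hr => by
        refine (measureReal_mono fun y hy => ?_).trans (hball i r (Metric.diam_nonneg.trans_lt hr))
        exact (Metric.dist_le_diam_of_mem' hbdd hy hi).trans_lt hr
      have h2 : (𝓘.moranMeasure ω).real U ≤ M * Metric.diam U ^ s := by
        have hcont : ContinuousAt (fun r : ℝ => M * r ^ s) (Metric.diam U) :=
          (Real.continuousAt_rpow_const _ _ (Or.inr hs0.le)).const_mul M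
        exact ge_of_tendsto (hcont.tendsto.mono_left (nhdsWithin_le_nhds (s := Ioi _)))
          (eventually_nhdsWithin_of_forall fun r hr => h1 r hr)
      rw [← ofReal_measureReal, ← ENNReal.ofReal_toReal hbdd, ← Metric.diam,
        ENNReal.ofReal_rpow_of_nonneg Metric.diam_nonneg hs0.le, ← ENNReal.ofReal_mul hMpos.le]
      exact ENNReal.ofReal_le_ofReal h2
    · have h0 : 𝓘.moranMeasure ω (𝓘.moranSet u)ᶜ = 0 := by
        have hm : MeasurableSet (𝓘.moranSet u) := by
          rw [← range_code]
          exact (isCompact_range (𝓘.continuous_code _)).isClosed.measurableSet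
        exact (prob_compl_eq_zero_iff hm).mpr (𝓘.moranMeasure_moranSet ω)
      have hsub : U ⊆ (𝓘.moranSet u)ᶜ := by
        rw [← range_code]
        rintro x hx ⟨i, rfl⟩
        exact hUF ⟨i, hx⟩
      rw [measure_mono_null hsub h0]
      exact zero_le
  have hM0 : ENNReal.ofReal M ≠ 0 := (ENNReal.ofReal_pos.mpr hMpos).ne'
  have hle : (ENNReal.ofReal M)⁻¹ • 𝓘.moranMeasure ω ≤ μH[s] := by
    refine Measure.le_hausdorffMeasure _ _ ⊤ ENNReal.zero_lt_top fun U _ => ?_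
    rw [Measure.smul_apply, smul_eq_mul, ENNReal.inv_mul_le_iff hM0 ENNReal.ofReal_ne_top]
    exact hset U
  have hne : μH[((s.toNNReal : NNReal) : ℝ)] (𝓘.moranSet u) ≠ 0 := by
    rw [Real.coe_toNNReal _ hs0.le]
    refine (lt_of_lt_of_le ?_ (hle (𝓘.moranSet u))).ne'
    rw [Measure.smul_apply, 𝓘.moranMeasure_moranSet, smul_eq_mul, mul_one]
    exact ENNReal.inv_pos.mpr ENNReal.ofReal_ne_top
  exact le_dimH_of_hausdorffMeasure_ne_zero hne

theorem ediam_moranInterval_le (u : ℕ → 𝒜) (i : ℕ → Fin K) (n : ℕ) :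
    Metric.ediam (𝓘.moranInterval u i n) ≤ ENNReal.ofReal (𝓘.len u i n) := by
  refine Metric.ediam_le fun x hx y hy => ?_
  obtain ⟨a, rfl⟩ := hx
  obtain ⟨b, rfl⟩ := hy
  rw [edist_dist, dist_comp]
  refine ENNReal.ofReal_le_ofReal (mul_le_of_le_one_right (𝓘.len_pos u i n).le ?_)
  rw [Subtype.dist_eq, Real.dist_eq, abs_le]
  constructor <;> linarith [a.2.1, a.2.2, b.2.1, b.2.2]

/-- The Moran intervals of one step cover the Moran set, and the sum of the powers `e` of their
lengths is the product of the sums `∑ i, a i ^ e`, which tends to `0` for `D < e`. -/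
theorem dimH_moranSet_le {u : ℕ → 𝒜} {D : ℝ} (hD : 0 ≤ D)
    (hg : HasSmallBlockSums fun n => Real.log (𝓘.ratioSum D (u n))) {ε : ℝ} (hε : 0 < ε) :
    dimH (𝓘.moranSet u) ≤ ENNReal.ofReal (D + ε) := by
  set e := D + ε with he
  have he0 : 0 ≤ e := by positivity
  set b := -Real.log 𝓘.B with hb
  have hbpos : 0 < b := 𝓘.log_inv_B_pos
  obtain ⟨L, -, C, hC⟩ := hg (ε * b / 2) (by positivity)
  set ext : ∀ n, (Fin n → Fin K) → ℕ → Fin K := fun n w m =>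
    if h : m < n then w ⟨m, h⟩ else 𝓘.first with hext
  have hlen : ∀ n w, 𝓘.len u (ext n w) n = ∏ m : Fin n, 𝓘.ratio (u m) (w m) := fun n w => by
    rw [len, Finset.prod_range]
    exact Finset.prod_congr rfl fun m _ => by simp [hext]
  have hprod : ∀ n, ∑ w : Fin n → Fin K, 𝓘.len u (ext n w) n ^ e
      ≤ Real.exp (C - ε * b / 2 * n) := by
    intro n
    have h1 : ∑ w : Fin n → Fin K, 𝓘.len u (ext n w) n ^ e
        = ∏ m ∈ Finset.range n, 𝓘.ratioSum e (u m) := by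
      rw [Finset.prod_range]
      simp only [ratioSum]
      rw [Fintype.prod_sum]
      refine Finset.sum_congr rfl fun w _ => ?_
      rw [hlen, Real.finsetProd_rpow _ _ fun m _ => 𝓘.ratio_nonneg _ _]
    have h2 : ∏ m ∈ Finset.range n, 𝓘.ratioSum e (u m)
        ≤ ∏ m ∈ Finset.range n, (𝓘.B ^ ε * 𝓘.ratioSum D (u m)) :=
      Finset.prod_le_prod (fun m _ => (𝓘.ratioSum_pos _ _).le) fun m _ => by
        have := 𝓘.ratioSum_le_rpow_mul (x := D) (y := e) (by linarith) (u m)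
        rwa [he, add_sub_cancel_left] at this
    have h3 : ∏ m ∈ Finset.range n, (𝓘.B ^ ε * 𝓘.ratioSum D (u m))
        = Real.exp (∑ m ∈ Finset.range n, (-(ε * b) + Real.log (𝓘.ratioSum D (u m)))) := by
      rw [Real.exp_sum]
      refine Finset.prod_congr rfl fun m _ => ?_
      rw [Real.exp_add, Real.exp_log (𝓘.ratioSum_pos _ _), Real.rpow_def_of_pos 𝓘.B_pos, hb]
      congr 2
      ring
    rw [h1]
    refine h2.trans (h3.trans_le (Real.exp_le_exp.mpr ?_))
    have h4 := (le_abs_self _).trans (hC 0 n)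
    simp only [zero_add, Nat.cast_zero, Real.log_one, mul_zero, add_zero] at h4
    rw [Finset.sum_add_distrib, Finset.sum_const, Finset.card_range, nsmul_eq_mul]
    linarith
  have hH : μH[e] (𝓘.moranSet u) ≤ liminf (fun n => ∑ w : Fin n → Fin K,
      Metric.ediam (𝓘.moranInterval u (ext n w) n) ^ e) atTop := by
    refine Measure.hausdorffMeasure_le_liminf_sum e _ (fun n => ENNReal.ofReal (𝓘.B ^ n)) ?_ _
      (Eventually.of_forall fun n w => ?_) (Eventually.of_forall fun n x hx => ?_)
    · simpa using ENNReal.tendsto_ofReal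
        (tendsto_pow_atTop_nhds_zero_of_lt_one 𝓘.B_pos.le 𝓘.B_lt_one)
    · exact (𝓘.ediam_moranInterval_le u _ n).trans (ENNReal.ofReal_le_ofReal (𝓘.len_le_pow u _ n))
    · rw [← range_code] at hx
      obtain ⟨i, rfl⟩ := hx
      refine mem_iUnion.mpr ⟨fun m => i m, ?_⟩
      have h := 𝓘.code_mem u i n
      rwa [moranInterval, 𝓘.comp_congr u (j := ext n fun m => i m)
        fun m hm => by simp [hext, hm]] at h
  have hzero : Tendsto (fun n => ∑ w : Fin n → Fin K,
      Metric.ediam (𝓘.moranInterval u (ext n w) n) ^ e) atTop (𝓝 0) := by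
    have hlim : Tendsto (fun n : ℕ => ENNReal.ofReal (Real.exp (C - ε * b / 2 * n))) atTop
        (𝓝 0) := by
      rw [← ENNReal.ofReal_zero]
      refine ENNReal.tendsto_ofReal (Real.tendsto_exp_atBot.comp ?_)
      simp only [sub_eq_add_neg]
      exact tendsto_atBot_add_const_left _ _ (tendsto_neg_atTop_atBot.comp
        (tendsto_natCast_atTop_atTop.const_mul_atTop (by positivity)))
    refine tendsto_of_tendsto_of_tendsto_of_le_of_le tendsto_const_nhds hlim
      (fun _ => zero_le) fun n => ?_
    calc _ ≤ ∑ w : Fin n → Fin K, ENNReal.ofReal (𝓘.len u (ext n w) n ^ e) := by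
          refine Finset.sum_le_sum fun w _ => ?_
          rw [← ENNReal.ofReal_rpow_of_nonneg (𝓘.len_pos _ _ _).le he0]
          exact ENNReal.rpow_le_rpow (𝓘.ediam_moranInterval_le u _ n) he0
      _ = ENNReal.ofReal (∑ w : Fin n → Fin K, 𝓘.len u (ext n w) n ^ e) :=
          (ENNReal.ofReal_sum_of_nonneg fun w _ =>
            Real.rpow_nonneg (𝓘.len_pos _ _ _).le e).symm
      _ ≤ _ := ENNReal.ofReal_le_ofReal (hprod n)
  rw [hzero.liminf_eq, nonpos_iff_eq_zero] at hH
  refine dimH_le_of_hausdorffMeasure_ne_top (d := e.toNNReal) ?_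
  rw [Real.coe_toNNReal _ he0, hH]
  exact ENNReal.zero_ne_top

theorem dimH_moranSet {u : ℕ → 𝒜} {D : ℝ} (hD : 0 < D)
    (hg : HasSmallBlockSums fun n => Real.log (𝓘.ratioSum D (u n))) :
    dimH (𝓘.moranSet u) = ENNReal.ofReal D := by
  apply le_antisymm
  · refine ENNReal.le_of_forall_pos_le_add fun ε hε _ => ?_
    have h := 𝓘.dimH_moranSet_le hD.le hg (NNReal.coe_pos.mpr hε)
    rwa [ENNReal.ofReal_add hD.le ε.coe_nonneg, ENNReal.ofReal_coe_nnreal] at h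
  · refine ENNReal.le_of_forall_pos_le_add fun ε hε _ => ?_
    rw [← ENNReal.ofReal_coe_nnreal (p := ε)]
    rcases lt_or_ge (ε : ℝ) D with h | h
    · have h1 := 𝓘.ofReal_sub_le_dimH_moranSet (ω := fun m => (u m, 𝓘.gibbsWeight D (u m)))
        (fun m i => 𝓘.gibbsWeight_pos D (u m) i)
        (fun m i => (𝓘.log_gibbsWeight D (u m) i).le) hg.neg (NNReal.coe_pos.mpr hε) h
      calc ENNReal.ofReal D = ENNReal.ofReal (D - ε) + ENNReal.ofReal ε := by
            rw [← ENNReal.ofReal_add (by linarith) ε.coe_nonneg, sub_add_cancel]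
        _ ≤ _ := by gcongr
    · exact (ENNReal.ofReal_le_ofReal h).trans le_add_self

end IFSFamily

/-! ### The pressure equation and the choice of weights -/

namespace IFSFamily

variable [MeasurableSpace 𝒜] (𝓘 : IFSFamily 𝒜 K)

theorem measurable_ratioSum (x : ℝ) : Measurable (𝓘.ratioSum x) :=
  Finset.measurable_sum _ fun i _ => (𝓘.measurable_ratio i).pow_const x

theorem log_A_neg : Real.log 𝓘.A < 0 :=
  Real.log_neg 𝓘.A_pos (𝓘.A_le_B.trans_lt 𝓘.B_lt_one)

theorem abs_log_ratioSum_le {x : ℝ} (hx : 0 ≤ x) (u : 𝒜) :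
    |Real.log (𝓘.ratioSum x u)| ≤ Real.log K - x * Real.log 𝓘.A := by
  have h1 := Real.log_le_log (Real.rpow_pos_of_pos 𝓘.A_pos x) (𝓘.rpow_A_le_ratioSum hx u)
  have h2 := Real.log_le_log (𝓘.ratioSum_pos x u) (𝓘.ratioSum_le hx u)
  rw [Real.log_rpow 𝓘.A_pos] at h1
  have h3 := Real.log_nonneg 𝓘.one_le_natCast_K
  have h4 := mul_nonneg hx (neg_nonneg.mpr 𝓘.log_A_neg.le)
  rw [abs_le]
  constructor <;> linarith

variable (Q : Measure 𝒜) [IsProbabilityMeasure Q]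

theorem integrable_log_ratioSum {x : ℝ} (hx : 0 ≤ x) :
    Integrable (fun u => Real.log (𝓘.ratioSum x u)) Q :=
  Integrable.of_bound (𝓘.measurable_ratioSum x).log.aestronglyMeasurable _
    (Eventually.of_forall fun u => 𝓘.abs_log_ratioSum_le hx u)

theorem integral_log_ratioSum_le {x y : ℝ} (hx : 0 ≤ x) (hxy : x ≤ y) :
    ∫ u, Real.log (𝓘.ratioSum y u) ∂Q
      ≤ (y - x) * Real.log 𝓘.B + ∫ u, Real.log (𝓘.ratioSum x u) ∂Q := by
  have hi := 𝓘.integrable_log_ratioSum Q hx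
  calc ∫ u, Real.log (𝓘.ratioSum y u) ∂Q
      ≤ ∫ u, ((y - x) * Real.log 𝓘.B + Real.log (𝓘.ratioSum x u)) ∂Q := by
        refine integral_mono (𝓘.integrable_log_ratioSum Q (hx.trans hxy))
          ((integrable_const _).add hi) fun u => ?_
        have h := Real.log_le_log (𝓘.ratioSum_pos y u) (𝓘.ratioSum_le_rpow_mul hxy u)
        rwa [Real.log_mul (Real.rpow_pos_of_pos 𝓘.B_pos _).ne' (𝓘.ratioSum_pos x u).ne',
          Real.log_rpow 𝓘.B_pos] at h
    _ = _ := by rw [integral_add (integrable_const _) hi]; simp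

theorem exists_integral_log_ratioSum_eq_zero :
    ∃ D : ℝ, 0 < D ∧ ∫ u, Real.log (𝓘.ratioSum D u) ∂Q = 0 := by
  have hcont : ContinuousOn (fun x : ℝ => ∫ u, Real.log (𝓘.ratioSum x u) ∂Q) (Icc 0 1) := by
    refine continuousOn_of_dominated (bound := fun _ => Real.log K - Real.log 𝓘.A)
      (fun x _ => (𝓘.measurable_ratioSum x).log.aestronglyMeasurable)
      (fun x hx => Eventually.of_forall fun u => ?_) (integrable_const _)
      (Eventually.of_forall fun u => Continuous.continuousOn ?_)
    · refine (𝓘.abs_log_ratioSum_le hx.1 u).trans ?_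
      have := mul_le_mul_of_nonneg_right hx.2 (neg_nonneg.mpr 𝓘.log_A_neg.le)
      linarith
    · refine Continuous.log (continuous_finsetSum _ fun i _ => ?_)
        fun x => (𝓘.ratioSum_pos x u).ne'
      exact Real.continuous_const_rpow (𝓘.ratio_pos u i).ne'
  have h0 : ∫ u, Real.log (𝓘.ratioSum 0 u) ∂Q = Real.log K := by simp [ratioSum]
  have hK : 0 < Real.log K := Real.log_pos (by exact_mod_cast 𝓘.two_le)
  have h1 : ∫ u, Real.log (𝓘.ratioSum 1 u) ∂Q ≤ 0 := by
    refine integral_nonpos fun u => Real.log_nonpos (𝓘.ratioSum_pos 1 u).le ?_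
    simp only [ratioSum, Real.rpow_one]
    exact (𝓘.sum_ratio_le u).trans 𝓘.B_lt_one.le
  obtain ⟨D, hD, hD0⟩ := intermediate_value_Icc' zero_le_one hcont
    (show (0 : ℝ) ∈ Icc _ _ from ⟨h1, by rw [h0]; exact hK.le⟩)
  refine ⟨D, hD.1.lt_of_ne ?_, hD0⟩
  rintro rfl
  simp only [h0] at hD0
  exact hK.ne' hD0

theorem integral_log_ratioSum_eq_zero_iff {D x : ℝ} (hD : 0 ≤ D)
    (hD0 : ∫ u, Real.log (𝓘.ratioSum D u) ∂Q = 0) (hx : 0 ≤ x) :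
    ∫ u, Real.log (𝓘.ratioSum x u) ∂Q = 0 ↔ x = D := by
  refine ⟨fun h => ?_, fun h => h ▸ hD0⟩
  have hB := 𝓘.log_inv_B_pos
  rcases lt_trichotomy x D with hlt | heq | hlt
  · have h1 := 𝓘.integral_log_ratioSum_le Q hx hlt.le
    rw [h, hD0] at h1
    have := mul_pos (sub_pos.mpr hlt) hB
    linarith
  · exact heq
  · have h1 := 𝓘.integral_log_ratioSum_le Q hD hlt.le
    rw [h, hD0] at h1
    have := mul_pos (sub_pos.mpr hlt) hB
    linarith

theorem univ_nonempty (𝓘 : IFSFamily 𝒜 K) : (Finset.univ : Finset (Fin K)).Nonempty :=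
  ⟨𝓘.first, Finset.mem_univ _⟩

/-- The largest value of `log (p i / a i ^ d)` over all letters `i`. -/
noncomputable def excess (d : ℝ) (l : 𝒜 × Weights K) : ℝ :=
  Finset.univ.sup' 𝓘.univ_nonempty fun i => Real.log (l.2.1 i) - d * Real.log (𝓘.ratio l.1 i)

theorem log_weight_le (d : ℝ) (l : 𝒜 × Weights K) (i : Fin K) :
    Real.log (l.2.1 i) ≤ d * Real.log (𝓘.ratio l.1 i) + 𝓘.excess d l := by
  have := Finset.le_sup' (fun i => Real.log (l.2.1 i) - d * Real.log (𝓘.ratio l.1 i))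
    (Finset.mem_univ i)
  rw [excess]
  linarith

theorem exists_log_weight_eq (d : ℝ) (l : 𝒜 × Weights K) :
    ∃ i, Real.log (l.2.1 i) = d * Real.log (𝓘.ratio l.1 i) + 𝓘.excess d l := by
  obtain ⟨i, -, hi⟩ := Finset.exists_mem_eq_sup' 𝓘.univ_nonempty
    fun i => Real.log (l.2.1 i) - d * Real.log (𝓘.ratio l.1 i)
  exact ⟨i, by rw [excess, hi]; ring⟩

theorem measurable_excess (d : ℝ) : Measurable (𝓘.excess d) := by
  have h : Measurable (Finset.univ.sup' 𝓘.univ_nonempty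
      fun i (l : 𝒜 × Weights K) => Real.log (l.2.1 i) - d * Real.log (𝓘.ratio l.1 i)) := by
    refine Finset.measurable_sup' _ fun i _ => Measurable.sub (Measurable.log ?_)
      (((𝓘.measurable_ratio i).comp measurable_fst).log.const_mul d)
    exact (measurable_pi_apply i).comp (measurable_subtype_coe.comp measurable_snd)
  convert h using 1
  ext l
  exact (Finset.sup'_apply 𝓘.univ_nonempty
    (fun i (l : 𝒜 × Weights K) => Real.log (l.2.1 i) - d * Real.log (𝓘.ratio l.1 i)) l).symm

theorem abs_excess_le {d c : ℝ} (hd : 0 ≤ d) (hc : 0 < c) {l : 𝒜 × Weights K}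
    (hl : ∀ i, c ≤ l.2.1 i) : |𝓘.excess d l| ≤ -Real.log c - d * Real.log 𝓘.A := by
  obtain ⟨i, hi⟩ := 𝓘.exists_log_weight_eq d l
  have h1 := Real.log_le_log hc (hl i)
  have hp1 : l.2.1 i ≤ 1 := by
    rw [← l.2.2.2]
    exact Finset.single_le_sum (fun j _ => l.2.2.1 j) (Finset.mem_univ _)
  have h2 := Real.log_nonpos (l.2.2.1 i) hp1
  have h3 := Real.log_le_log 𝓘.A_pos (𝓘.le_ratio l.1 i)
  have h4 := Real.log_nonpos (𝓘.ratio_nonneg l.1 i) ((𝓘.ratio_le l.1 i).trans 𝓘.B_lt_one.le)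
  have h5 := mul_le_mul_of_nonneg_left h3 hd
  have h6 := mul_nonneg hd (neg_nonneg.mpr h4)
  rw [abs_le]
  constructor <;> linarith

theorem rpow_B_lt_one {d : ℝ} (hd : 0 < d) : 𝓘.B ^ d < 1 :=
  Real.rpow_lt_one 𝓘.B_pos.le 𝓘.B_lt_one hd

/-- The mixture, in the proportion `1 - s` to `s`, of the weights `a i ^ d / ∑ j, a j ^ d` with
weights that give the distinguished letter at least `B ^ d`, where `B` bounds its ratio, and all
other letters the same positive weight. -/
noncomputable def mixedWeight {d : ℝ} (hd : 0 < d) (s : unitInterval) (u : 𝒜) : Weights K :=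
  ⟨fun i => (1 - s) * (𝓘.gibbsWeight d u).1 i
      + s * ((1 - 𝓘.B ^ d) / K + if i = 𝓘.first then 𝓘.B ^ d else 0), by
    have hB := 𝓘.rpow_B_lt_one hd
    have hB0 := Real.rpow_pos_of_pos 𝓘.B_pos d
    have hK := 𝓘.natCast_K_pos
    constructor
    · intro i
      have h1 := mul_nonneg (sub_nonneg.mpr s.2.2) ((𝓘.gibbsWeight d u).2.1 i)
      have h2 : 0 ≤ (1 - 𝓘.B ^ d) / K + if i = 𝓘.first then 𝓘.B ^ d else 0 :=
        add_nonneg (div_nonneg (by linarith) hK.le) (by split_ifs <;> linarith)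
      exact add_nonneg h1 (mul_nonneg s.2.1 h2)
    · have hg := (𝓘.gibbsWeight d u).2.2
      rw [Finset.sum_add_distrib, ← Finset.mul_sum, ← Finset.mul_sum, hg, Finset.sum_add_distrib]
      simp only [Finset.sum_const, Finset.card_univ, Fintype.card_fin, nsmul_eq_mul,
        Finset.sum_ite_eq', Finset.mem_univ, if_true]
      field_simp
      ring⟩

theorem mixedWeight_apply {d : ℝ} (hd : 0 < d) (s : unitInterval) (u : 𝒜) (i : Fin K) :
    (𝓘.mixedWeight hd s u).1 i = (1 - s) * (𝓘.gibbsWeight d u).1 i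
      + s * ((1 - 𝓘.B ^ d) / K + if i = 𝓘.first then 𝓘.B ^ d else 0) := rfl

theorem measurable_mixedWeight {d : ℝ} (hd : 0 < d) (s : unitInterval) :
    Measurable (𝓘.mixedWeight hd s) := by
  refine Measurable.subtype_mk (measurable_pi_lambda _ fun i => ?_)
  exact ((((𝓘.measurable_ratio i).pow_const d).div
    (𝓘.measurable_ratioSum d)).const_mul _).add_const _

theorem exists_pos_le_mixedWeight {d : ℝ} (hd : 0 < d) :
    ∃ c > 0, ∀ s u i, c ≤ (𝓘.mixedWeight hd s u).1 i := by
  have hB := 𝓘.rpow_B_lt_one hd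
  have hB0 := Real.rpow_pos_of_pos 𝓘.B_pos d
  have hA0 := Real.rpow_pos_of_pos 𝓘.A_pos d
  have hK := 𝓘.natCast_K_pos
  refine ⟨min (𝓘.A ^ d / K) ((1 - 𝓘.B ^ d) / K),
    lt_min (div_pos hA0 hK) (div_pos (by linarith) hK), fun s u i => ?_⟩
  set c := min (𝓘.A ^ d / K) ((1 - 𝓘.B ^ d) / K)
  have h1 : c ≤ (𝓘.gibbsWeight d u).1 i := (min_le_left _ _).trans
    (div_le_div₀ (Real.rpow_nonneg (𝓘.ratio_nonneg u i) d)
      (Real.rpow_le_rpow 𝓘.A_pos.le (𝓘.le_ratio u i) hd.le) (𝓘.ratioSum_pos d u)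
      (𝓘.ratioSum_le hd.le u))
  have h2 : c ≤ (1 - 𝓘.B ^ d) / K + if i = 𝓘.first then 𝓘.B ^ d else 0 :=
    (min_le_right _ _).trans (le_add_of_nonneg_right (by split_ifs <;> linarith))
  rw [mixedWeight_apply]
  calc c = (1 - s) * c + s * c := by ring
    _ ≤ _ := add_le_add (mul_le_mul_of_nonneg_left h1 (sub_nonneg.mpr s.2.2))
      (mul_le_mul_of_nonneg_left h2 s.2.1)

/-- By the intermediate value theorem some mixture has mean excess `0`: the excess of the weights
`a i ^ d / ∑ j, a j ^ d` is `-log (∑ j, a j ^ d)`, with mean at most `0`, and the excess at the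
other end is nonnegative because of the distinguished letter. -/
theorem exists_integral_excess_mixedWeight_eq_zero {d : ℝ} (hd : 0 < d)
    (hQ : 0 ≤ ∫ u, Real.log (𝓘.ratioSum d u) ∂Q) :
    ∃ s, ∫ u, 𝓘.excess d (u, 𝓘.mixedWeight hd s u) ∂Q = 0 := by
  obtain ⟨c, hc, hcs⟩ := 𝓘.exists_pos_le_mixedWeight hd
  have hcont : Continuous fun s => ∫ u, 𝓘.excess d (u, 𝓘.mixedWeight hd s u) ∂Q := by
    refine continuous_of_dominated (bound := fun _ => -Real.log c - d * Real.log 𝓘.A)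
      (fun s => ((𝓘.measurable_excess d).comp
        (measurable_id.prodMk (𝓘.measurable_mixedWeight hd s))).aestronglyMeasurable)
      (fun s => Eventually.of_forall fun u => 𝓘.abs_excess_le hd.le hc fun i => hcs s u i)
      (integrable_const _) (Eventually.of_forall fun u => ?_)
    refine Continuous.finset_sup'_apply _ fun i _ => Continuous.sub
      (Continuous.log ?_ fun s => (hc.trans_le (hcs s u i)).ne')
      (continuous_const (y := d * Real.log (𝓘.ratio u i)))
    simp only [mixedWeight_apply]
    fun_prop
  have h0 : ∫ u, 𝓘.excess d (u, 𝓘.mixedWeight hd 0 u) ∂Q ≤ 0 := by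
    have h : ∀ u, 𝓘.excess d (u, 𝓘.mixedWeight hd 0 u) = -Real.log (𝓘.ratioSum d u) := fun u => by
      obtain ⟨i, hi⟩ := 𝓘.exists_log_weight_eq d (u, 𝓘.mixedWeight hd 0 u)
      have h1 : (𝓘.mixedWeight hd 0 u).1 i = (𝓘.gibbsWeight d u).1 i := by
        simp [mixedWeight_apply]
      simp only [h1, log_gibbsWeight] at hi
      linarith
    simp only [h, integral_neg]
    linarith
  have h1 : 0 ≤ ∫ u, 𝓘.excess d (u, 𝓘.mixedWeight hd 1 u) ∂Q := by
    refine integral_nonneg fun u => ?_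
    have h2 := 𝓘.log_weight_le d (u, 𝓘.mixedWeight hd 1 u) 𝓘.first
    have h3 : 𝓘.ratio u 𝓘.first ^ d ≤ (𝓘.mixedWeight hd 1 u).1 𝓘.first := by
      rw [mixedWeight_apply]
      simp only [Icc.coe_one, sub_self, zero_mul, zero_add, one_mul, if_true]
      have h4 : 0 ≤ (1 - 𝓘.B ^ d) / K :=
        div_nonneg (by linarith [𝓘.rpow_B_lt_one hd]) 𝓘.natCast_K_pos.le
      have h5 := Real.rpow_le_rpow (𝓘.ratio_nonneg u 𝓘.first) (𝓘.ratio_le u 𝓘.first) hd.le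
      linarith
    have h6 := Real.log_le_log (Real.rpow_pos_of_pos (𝓘.ratio_pos u _) d) h3
    rw [Real.log_rpow (𝓘.ratio_pos u _)] at h6
    simp only [Pi.zero_apply]
    linarith
  exact mem_range_of_exists_le_of_exists_ge hcont ⟨0, h0⟩ ⟨1, h1⟩

theorem ae_moranMeasure {P : Measure (𝒜 × Weights K)} [IsProbabilityMeasure P] {d c : ℝ}
    (hd : 0 < d) (hc : 0 < c) (hP : ∀ᵐ l ∂P, ∀ i, c ≤ l.2.1 i)
    (h0 : ∫ l, 𝓘.excess d l ∂P = 0) :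
    ∀ᵐ ω ∂(Measure.infinitePi fun _ : ℕ => P), IsDoubling (𝓘.moranMeasure ω) ∧
      ∀ Φ : ℝ → ℝ, IsLargeDimensionFunction Φ →
        lowerPhiDim Φ (𝓘.moranMeasure ω) = (d : EReal) := by
  have hall : ∀ᵐ ω ∂(Measure.infinitePi fun _ : ℕ => P), ∀ n i, c ≤ (ω n).2.1 i :=
    ae_all_iff.mpr fun n =>
      (measurePreserving_eval_infinitePi (fun _ : ℕ => P) n).quasiMeasurePreserving.ae hP
  have hsums := ae_hasSmallBlockSums P (𝓘.measurable_excess d)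
    (hP.mono fun l hl => 𝓘.abs_excess_le hd.le hc hl) h0
  filter_upwards [hall, hsums] with ω hω hg
  have hpos : ∀ m i, 0 < (ω m).2.1 i := fun m i => hc.trans_le (hω m i)
  exact ⟨𝓘.isDoubling_moranMeasure hc hω, fun Φ hΦ => 𝓘.lowerPhiDim_moranMeasure hd hpos
    (fun m i => 𝓘.log_weight_le d (ω m) i) (fun m => 𝓘.exists_log_weight_eq d (ω m)) hg hΦ⟩

theorem exists_admissibleLaw {d : ℝ} (hd : 0 < d)
    (hQ : 0 ≤ ∫ u, Real.log (𝓘.ratioSum d u) ∂Q) :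
    ∃ P : ProbabilityMeasure (𝒜 × Weights K),
      IsAdmissibleLaw Q (P : Measure (𝒜 × Weights K)) ∧
      ∀ᵐ ω ∂(Measure.infinitePi fun _ : ℕ => (P : Measure (𝒜 × Weights K))),
        IsDoubling (𝓘.moranMeasure ω) ∧ ∀ Φ : ℝ → ℝ, IsLargeDimensionFunction Φ →
          lowerPhiDim Φ (𝓘.moranMeasure ω) = (d : EReal) := by
  obtain ⟨s, hs⟩ := 𝓘.exists_integral_excess_mixedWeight_eq_zero Q hd hQ
  obtain ⟨c, hc, hcs⟩ := 𝓘.exists_pos_le_mixedWeight hd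
  have hmeas : Measurable fun u => (u, 𝓘.mixedWeight hd s u) :=
    measurable_id.prodMk (𝓘.measurable_mixedWeight hd s)
  set P : Measure (𝒜 × Weights K) := Q.map fun u => (u, 𝓘.mixedWeight hd s u) with hPdef
  have hPprob : IsProbabilityMeasure P := Measure.isProbabilityMeasure_map hmeas.aemeasurable
  have hset : MeasurableSet {l : 𝒜 × Weights K | ∀ i, c ≤ l.2.1 i} := by
    rw [ofPred_forall]
    exact MeasurableSet.iInter fun i => measurableSet_le measurable_const
      ((measurable_pi_apply i).comp (measurable_subtype_coe.comp measurable_snd))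
  have hP : ∀ᵐ l ∂P, ∀ i, c ≤ l.2.1 i :=
    (ae_map_iff hmeas.aemeasurable hset).mpr (Eventually.of_forall fun u i => hcs s u i)
  have h0 : ∫ l, 𝓘.excess d l ∂P = 0 := by
    rw [hPdef, integral_map hmeas.aemeasurable (𝓘.measurable_excess d).aestronglyMeasurable]
    exact hs
  refine ⟨⟨P, hPprob⟩, ⟨?_, 1, one_pos, fun i => ?_⟩, 𝓘.ae_moranMeasure (P := P) hd hc hP h0⟩
  · change P.map Prod.fst = Q
    rw [hPdef, Measure.map_map measurable_fst hmeas]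
    exact Measure.map_id
  · change ∫⁻ l, ENNReal.ofReal (l.2.1 i) ^ (-1 : ℝ) ∂P < ∞
    calc ∫⁻ l, ENNReal.ofReal (l.2.1 i) ^ (-1 : ℝ) ∂P
        ≤ ∫⁻ _, (ENNReal.ofReal c)⁻¹ ∂P := by
          refine lintegral_mono_ae (hP.mono fun l hl => ?_)
          rw [ENNReal.rpow_neg_one]
          exact ENNReal.inv_le_inv.mpr (ENNReal.ofReal_le_ofReal (hl i))
      _ < ∞ := by
          rw [lintegral_const, measure_univ, mul_one]
          exact ENNReal.inv_lt_top.mpr (ENNReal.ofReal_pos.mpr hc)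

end IFSFamily

end RandomMoran

theorem mainTheorem2 {𝒜 : Type*} [MeasurableSpace 𝒜] {K : ℕ}
    (𝓘 : RandomMoran.IFSFamily 𝒜 K) (Q : Measure 𝒜) [IsProbabilityMeasure Q] :
    ∃ D : ℝ, 0 < D ∧
      (∀ᵐ u ∂(Measure.infinitePi fun _ : ℕ => Q), dimH (𝓘.moranSet u) = ENNReal.ofReal D) ∧
      (∀ x : ℝ, 0 ≤ x → (∫ u, Real.log (∑ i, 𝓘.ratio u i ^ x) ∂Q = 0 ↔ x = D)) ∧
      ∀ d : ℝ, 0 < d → d ≤ D →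
        ∃ P : ProbabilityMeasure (𝒜 × RandomMoran.Weights K),
          RandomMoran.IsAdmissibleLaw Q (P : Measure (𝒜 × RandomMoran.Weights K)) ∧
          ∀ᵐ ω ∂(Measure.infinitePi fun _ : ℕ => (P : Measure (𝒜 × RandomMoran.Weights K))),
            RandomMoran.IsDoubling (𝓘.moranMeasure ω) ∧
            ∀ Φ : ℝ → ℝ, RandomMoran.IsLargeDimensionFunction Φ →
              RandomMoran.lowerPhiDim Φ (𝓘.moranMeasure ω) = (d : EReal) := by
  obtain ⟨D, hD, hD0⟩ := 𝓘.exists_integral_log_ratioSum_eq_zero Q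
  refine ⟨D, hD, ?_, fun x hx => 𝓘.integral_log_ratioSum_eq_zero_iff Q hD.le hD0 hx,
    fun d hd hdD => 𝓘.exists_admissibleLaw Q hd ?_⟩
  · filter_upwards [RandomMoran.ae_hasSmallBlockSums Q (𝓘.measurable_ratioSum D).log
      (Eventually.of_forall fun u => 𝓘.abs_log_ratioSum_le hD.le u) hD0] with u hu
    exact 𝓘.dimH_moranSet hD hu
  · have h := 𝓘.integral_log_ratioSum_le Q hd.le hdD
    rw [hD0] at h
    have := mul_nonneg (sub_nonneg.mpr hdD) 𝓘.log_inv_B_pos.le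
    linarith
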